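/- A second countable topological graph $E=(E^0,E^1,r,s)$ consists of second countable locally compact Hausdorff spaces $E^0$ (vertices) and $E^1$ (edges), a local homeomorphism $s:E^1\to E^0$ and a continuous map $r:E^1\to E^0$. For $n\ge 1$ let $E^n\subseteq (E^1)^n$, with the subspace topology of the product topology, be the space of paths $\alpha_1\cdots\alpha_n$ with $s(\alpha_i)=r(\alpha_{i+1})$ for $1\le i<n$; vertices are the paths of length $0$. Let $E^*=\bigsqcup_{n\ge 0}E^n$ with the disjoint union topology, and let $E^\infty$ be the set of infinite paths $\alpha_1\alpha_2\cdots$ with $s(\alpha_i)=r(\alpha_{i+1})$ for all $i\ge 1$. Put $r(\alpha)=r(\alpha_1)$ for paths of length at least $1$ and $r(v)=v$ for vertices; put $s(\alpha)=s(\alpha_{|\alpha|})$ for finite paths of length $|\alpha|\ge1$ and $s(v)=v$ for vertices. A vertex $v$ is regular if it has an open neighbourhood $W$ such that $\overline W$ and $r^{-1}(\overline W)\subseteq E^1$ are compact and $r(r^{-1}(W))=W$; $E^0_{reg}$ is the set of regular vertices. The boundary path space is $\partial E=\{\alpha\in E^*: s(\alpha)\notin E^0_{reg}\}\sqcup E^\infty$,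 with the topology generated by the sets $Z(U)\setminus Z(K)$, where $U\subseteq E^*$ is open, $K\subseteq E^*$ is compact, and, for $S\subseteq E^*$, $$Z(S)=\{\alpha\in\partial E : r(\alpha)\in S \text{ or } \alpha_1\cdots\alpha_n\in S\text{ for some }1\le n\le|\alpha|\}.$$ The shift $\sigma$ is defined on the boundary paths of length at least $1$ by removing the first edge, with $\sigma(\alpha_1)=s(\alpha_1)$ for paths of length $1$. An invariant measure on $\partial E$ is a regular Borel measure $\nu$ such that $\nu(\sigma(A))=\nu(A)$ for every Borel set $A$ of boundary paths of length at least $1$ on which $\sigma$ is injective. For a regular Borel measure $\mu$ on $E^0$, let $s^*\mu$ be the Borel measure on $E^1$ with $\int_{E^1}h\,\mathrm d s^*\mu=\int_{E^0}\sum_{e\in s^{-1}(v)}h(e)\,\mathrm d\mu(v)$ for all Borel $h:E^1\to[0,\infty]$. A vertex-invariant measure is a regular Borel measure $\mu$ on $E^0$ such that $\int_{E^1}f\circ r\,\mathrm d s^*\mu\le\int_{E^0}f\,\mathrm d\mu$ for all nonnegative $f\in C_c(E^0)$, with equality when $\operatorname{supp} f\subseteq E^0_{reg}$. **Proposition.**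 Let $E$ be a second countable topological graph. The map $\nu\mapsto r_*\nu$ (push-forward along $r:\partial E\to E^0$) is an affine bijection from the set of invariant measures on $\partial E$ onto the set of vertex-invariant measures on $E^0$. That is, both sets are convex, the map is a bijection between them, and $r_*(a\nu_1+b\nu_2)=a\,r_*\nu_1+b\,r_*\nu_2$ for all invariant measures $\nu_1,\nu_2$ and all $a,b\ge 0$ with $a+b=1$. -/

import Mathlib

open MeasureTheory
open scoped ENNReal NNReal

/-- A topological graph: locally compact Hausdorff spaces `V` of vertices and `E` of edges, a local
homeomorphism `s` (source) and a continuous map `r` (range) from `E` to `V`. -/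
structure TopologicalGraph (V E : Type*)
    [TopologicalSpace V] [T2Space V] [LocallyCompactSpace V]
    [TopologicalSpace E] [T2Space E] [LocallyCompactSpace E] where
  /-- the source map -/
  s : E → V
  /-- the range map -/
  r : E → V
  isLocalHomeomorph_s : IsLocalHomeomorph s
  continuous_r : Continuous r

namespace TopologicalGraph

variable {V E : Type*}
  [TopologicalSpace V] [T2Space V] [LocallyCompactSpace V]
  [TopologicalSpace E] [T2Space E] [LocallyCompactSpace E]
  (G : TopologicalGraph V E)

/-! ### Vertices -/

/-- The set of regular vertices. -/
def regularVertices : Set V :=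
  {v | ∃ W : Set V, IsOpen W ∧ v ∈ W ∧ IsCompact (closure W) ∧
    IsCompact (G.r ⁻¹' closure W) ∧ G.r '' (G.r ⁻¹' W) = W}

/-- The set of singular vertices. -/
def singularVertices : Set V := (G.regularVertices)ᶜ

/-! ### Finite and infinite paths -/

/-- The paths `α₁ ⋯ α_{n+1}` of length `n + 1`, with the edges indexed by `0, …, n`; topologized as
a subspace of the product `E^{n+1}`. -/
abbrev EdgePath (n : ℕ) : Type _ :=
  {α : Fin (n + 1) → E // ∀ i : Fin n, G.s (α i.castSucc) = G.r (α i.succ)}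

/-- The finite path space: the topological disjoint union of the vertices (paths of length `0`) and
of the spaces of paths of length `n + 1`, for `n : ℕ`. -/
abbrev FinPath : Type _ := V ⊕ (Σ n : ℕ, G.EdgePath n)

/-- The infinite paths `α₁α₂⋯`, with the edges indexed by `0, 1, 2, …`. -/
abbrev InfPath : Type _ := {α : ℕ → E // ∀ i : ℕ, G.s (α i) = G.r (α (i + 1))}

/-- The source map on finite paths. -/
def source : G.FinPath → V
  | Sum.inl v => v
  | Sum.inr ⟨n, α⟩ => G.s (α.1 (Fin.last n))

/-- The path consisting of the first `m + 1` edges of a path of length `n + 1`, where `m ≤ n`. -/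
def EdgePath.take {G : TopologicalGraph V E} {n : ℕ} (α : G.EdgePath n) (m : ℕ) (h : m ≤ n) :
    G.EdgePath m :=
  ⟨fun i => α.1 (Fin.castLE (Nat.succ_le_succ h) i), fun i => α.2 (Fin.castLE h i)⟩

/-- The path consisting of the first `m + 1` edges of an infinite path. -/
def InfPath.take {G : TopologicalGraph V E} (α : G.InfPath) (m : ℕ) : G.EdgePath m :=
  ⟨fun i => α.1 i, fun i => α.2 i⟩

/-- Removal of the first edge of a path of length at least two. -/
def EdgePath.tail {G : TopologicalGraph V E} {n : ℕ} (α : G.EdgePath (n + 1)) : G.EdgePath n :=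
  ⟨fun i => α.1 i.succ, fun i => α.2 i.succ⟩

/-- Removal of the first edge of an infinite path. -/
def InfPath.tail {G : TopologicalGraph V E} (α : G.InfPath) : G.InfPath :=
  ⟨fun i => α.1 (i + 1), fun i => α.2 (i + 1)⟩

/-! ### The boundary path space -/

/-- The boundary path space: finite paths (of length `≥ 0`) whose source is a singular vertex, and
infinite paths. -/
inductive BoundaryPath : Type _
  | fin (x : G.FinPath) (h : G.source x ∈ G.singularVertices) : BoundaryPath
  | inf (x : G.InfPath) : BoundaryPath

namespace BoundaryPath

variable {G}

/-- The range map on the boundary path space. -/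
def range : G.BoundaryPath → V
  | fin (Sum.inl v) _ => v
  | fin (Sum.inr ⟨_, α⟩) _ => G.r (α.1 0)
  | inf α => G.r (α.1 0)

/-- The boundary path is a vertex, that is, a path of length zero. -/
def IsVertex : G.BoundaryPath → Prop
  | fin (Sum.inl _) _ => True
  | fin (Sum.inr _) _ => False
  | inf _ => False

/-- The initial segments of length at least one of a boundary path: all paths `α₁ ⋯ αₙ` with
`1 ≤ n ≤ |α|`. -/
def initialSegments : G.BoundaryPath → Set G.FinPath
  | fin (Sum.inl _) _ => ∅
  | fin (Sum.inr ⟨n, α⟩) _ => {β | ∃ (m : ℕ) (h : m ≤ n), β = Sum.inr ⟨m, α.take m h⟩}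
  | inf α => {β | ∃ m : ℕ, β = Sum.inr ⟨m, InfPath.take α m⟩}

/-- `Z S` is the set of boundary paths `α` such that `r(α) ∈ S`, or `α₁ ⋯ αₙ ∈ S` for some
`1 ≤ n ≤ |α|`. -/
def Z (S : Set G.FinPath) : Set G.BoundaryPath :=
  {α | Sum.inl α.range ∈ S ∨ ∃ β ∈ α.initialSegments, β ∈ S}

/-- The topology of the boundary path space, generated by the sets `Z U \ Z K` with `U` open and `K`
compact in the finite path space. -/
instance : TopologicalSpace G.BoundaryPath :=
  TopologicalSpace.generateFrom
    {B | ∃ U K : Set G.FinPath, IsOpen U ∧ IsCompact K ∧ B = Z U \ Z K}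

/-- The boundary path space carries its Borel `σ`-algebra. -/
instance : MeasurableSpace G.BoundaryPath := borel _

instance : BorelSpace G.BoundaryPath := ⟨rfl⟩

/-- The backwards shift map. It is meant on boundary paths of positive length only; the value on a
vertex is a dummy (the vertex itself), and the map is never used there. -/
def shift : G.BoundaryPath → G.BoundaryPath
  | fin (Sum.inl v) h => fin (Sum.inl v) h
  | fin (Sum.inr ⟨0, α⟩) h => fin (Sum.inl (G.s (α.1 0))) h
  | fin (Sum.inr ⟨_ + 1, α⟩) h => fin (Sum.inr ⟨_, α.tail⟩) h
  | inf α => inf (InfPath.tail α)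

/-- The range map is continuous; in particular it is measurable, so push-forwards along it are
genuine. -/
theorem continuous_range : Continuous (range : G.BoundaryPath → V) := by
  refine ⟨fun U hU => TopologicalSpace.isOpen_generateFrom_of_mem ?_⟩
  refine ⟨Sum.inl '' U, ∅, isOpenMap_inl U hU, isCompact_empty, ?_⟩
  have h1 : (Z ∅ : Set G.BoundaryPath) = ∅ := by
    ext α; simp [Z]
  rw [h1, Set.sdiff_empty]
  ext α
  have h2 : ∀ β ∈ α.initialSegments, β ∉ Sum.inl '' U := by
    rintro β hβ ⟨v, _, rfl⟩
    rcases α with ⟨_ | ⟨n, α⟩, h⟩ | α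
    · exact hβ
    · obtain ⟨m, hm, h⟩ := hβ
      cases h
    · obtain ⟨m, h⟩ := hβ
      cases h
  simp only [Z, Set.mem_preimage, Set.mem_ofPred_eq, Set.mem_image, Sum.inl.injEq, exists_eq_right]
  constructor
  · exact Or.inl
  · rintro (h | ⟨β, hβ, h⟩)
    · exact h
    · exact absurd h (h2 β hβ)

/-- A regular Borel measure `ν` on the boundary path space is invariant if `ν(σ(A)) = ν(A)` for
every Borel set `A` of paths of positive length on which the shift `σ` is injective. -/
structure IsInvariant (ν : Measure G.BoundaryPath) : Prop where
  regular : ν.Regular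
  shift_image : ∀ A : Set G.BoundaryPath, MeasurableSet A → (∀ α ∈ A, ¬ α.IsVertex) →
    Set.InjOn shift A → ν (shift '' A) = ν A

end BoundaryPath

/-! ### Vertex-invariant measures -/

section Measures

variable [MeasurableSpace V] [MeasurableSpace E]

/-- The counting measure on the fibre of the source map over `v`. -/
noncomputable def fiberMeasure (v : V) : Measure E :=
  Measure.sum fun e : G.s ⁻¹' {v} => Measure.dirac (e : E)

/-- The measure `s^* μ` on the edges, obtained by integrating the counting measures on the fibres of
the source map against `μ`. -/
noncomputable def pullback (μ : Measure V) : Measure E := μ.bind G.fiberMeasure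

/-- The fibre counting measures form a measurable family, so that `pullback` is genuine. -/
theorem measurable_fiberMeasure [BorelSpace V] [BorelSpace E] [SecondCountableTopology E] :
    Measurable G.fiberMeasure := by
  classical
  refine Measure.measurable_of_measurable_coe _ fun B hB => ?_
  choose φ hφ hφs using G.isLocalHomeomorph_s
  obtain ⟨t, ht, htU⟩ := TopologicalSpace.countable_cover_nhds
    (f := fun e => (φ e).source) (fun e => (φ e).open_source.mem_nhds (hφ e))
  rcases isEmpty_or_nonempty E with hE | hE
  · have : (fun v => G.fiberMeasure v B) = fun _ => 0 := by
      funext v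
      simp [Set.eq_empty_of_isEmpty B]
    rw [this]; exact measurable_const
  have htne : t.Nonempty := by
    rw [Set.nonempty_iff_ne_empty]
    rintro rfl
    simp at htU
    exact (Set.empty_ne_univ (α := E)) htU
  obtain ⟨g, hg⟩ := ht.exists_eq_range htne
  set O : ℕ → Set E := fun n => (φ (g n)).source with hO
  have hOo : ∀ n, IsOpen (O n) := fun n => (φ (g n)).open_source
  have hOinj : ∀ n, Set.InjOn G.s (O n) := fun n => by
    rw [hφs (g n)]; exact (φ (g n)).injOn
  have hcov : ⋃ n, O n = Set.univ := by
    rw [← htU, hg, Set.biUnion_range]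
  have hOe : ∀ n, MeasurableEmbedding (fun x : O n => G.s x) := fun n => by
    have : Topology.IsOpenEmbedding (fun x : O n => G.s x) :=
      Topology.IsOpenEmbedding.of_continuous_injective_isOpenMap
        (G.isLocalHomeomorph_s.continuous.comp continuous_subtype_val)
        (fun x y h => Subtype.ext (hOinj n x.2 y.2 h))
        (G.isLocalHomeomorph_s.isOpenMap.comp (hOo n).isOpenMap_subtype_val)
    exact this.measurableEmbedding
  set D := fun n => B ∩ disjointed O n with hD
  have hDm : ∀ n, MeasurableSet (D n) := fun n =>
    hB.inter (MeasurableSet.disjointed (fun n => (hOo n).measurableSet) n)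
  have hDO : ∀ n, D n ⊆ O n := fun n => Set.inter_subset_right.trans (disjointed_subset O n)
  have himg : ∀ n, MeasurableSet (G.s '' D n) := fun n => by
    have := (hOe n).measurableSet_image' (measurable_subtype_coe (hDm n))
    convert this using 1
    ext v
    constructor
    · rintro ⟨e, he, rfl⟩
      exact ⟨⟨e, hDO n he⟩, he, rfl⟩
    · rintro ⟨e, he, rfl⟩
      exact ⟨e, he, rfl⟩
  have hBD : B = ⋃ n, D n := by
    rw [hD, ← Set.inter_iUnion, iUnion_disjointed, hcov, Set.inter_univ]
  have hDd : Pairwise (Function.onFun Disjoint D) := fun i j hij =>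
    (disjoint_disjointed O hij).mono Set.inter_subset_right Set.inter_subset_right
  have key : (fun v => G.fiberMeasure v B) =
      fun v => ∑' n, (G.s '' D n).indicator (fun _ => (1 : ℝ≥0∞)) v := by
    funext v
    rw [hBD, measure_iUnion hDd hDm]
    refine tsum_congr fun n => ?_
    rw [fiberMeasure, Measure.sum_apply _ (hDm n)]
    by_cases hv : v ∈ G.s '' D n
    · obtain ⟨e, he, rfl⟩ := hv
      rw [Set.indicator_of_mem (Set.mem_image_of_mem G.s he)]
      rw [tsum_eq_single (⟨e, rfl⟩ : G.s ⁻¹' {G.s e})]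
      · rw [Measure.dirac_apply' _ (hDm n), Set.indicator_of_mem he]; rfl
      · rintro ⟨e', he'⟩ hne
        rw [Measure.dirac_apply' _ (hDm n), Set.indicator_of_notMem]
        intro h
        exact hne (Subtype.ext (hOinj n (hDO n h) (hDO n he) he'))
    · rw [Set.indicator_of_notMem hv, ENNReal.tsum_eq_zero]
      rintro ⟨e, he⟩
      rw [Measure.dirac_apply' _ (hDm n), Set.indicator_of_notMem]
      exact fun h => hv ⟨e, h, he⟩
  rw [key]
  exact Measurable.tsum fun n => measurable_const.indicator (himg n)

/-- The defining formula of `s^* μ`, for all nonnegative Borel functions `h`. -/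
theorem lintegral_pullback [BorelSpace V] [BorelSpace E] [SecondCountableTopology E]
    (μ : Measure V) {h : E → ℝ≥0∞} (hh : Measurable h) :
    ∫⁻ e, h e ∂(G.pullback μ) = ∫⁻ v, ∑' e : G.s ⁻¹' {v}, h e ∂μ := by
  rw [pullback, Measure.lintegral_bind G.measurable_fiberMeasure.aemeasurable hh.aemeasurable]
  refine lintegral_congr fun v => ?_
  rw [fiberMeasure, lintegral_sum_measure]
  exact tsum_congr fun e => lintegral_dirac' _ hh

/-- A regular Borel measure `μ` on the vertices is vertex-invariant if
`∫ f ∘ r d(s^* μ) ≤ ∫ f dμ` for all nonnegative `f ∈ C_c(V)`, with equality when the support of `f`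
consists of regular vertices. (The left side may be infinite a priori, hence the use of the integral
with values in `[0, ∞]`.) -/
structure IsVertexInvariant (μ : Measure V) : Prop where
  regular : μ.Regular
  le : ∀ f : V → ℝ, Continuous f → HasCompactSupport f → (∀ v, 0 ≤ f v) →
    ∫⁻ e, ENNReal.ofReal (f (G.r e)) ∂(G.pullback μ) ≤ ∫⁻ v, ENNReal.ofReal (f v) ∂μ
  eq : ∀ f : V → ℝ, Continuous f → HasCompactSupport f → (∀ v, 0 ≤ f v) →
    tsupport f ⊆ G.regularVertices →
    ∫⁻ e, ENNReal.ofReal (f (G.r e)) ∂(G.pullback μ) = ∫⁻ v, ENNReal.ofReal (f v) ∂μ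

end Measures

end TopologicalGraph

set_option linter.unusedSectionVars false

section

open TopologicalSpace Topology Set

/-! ### One-point compactifications and closed graphs -/

section GeneralTopology

/-! An invariant measure on paths is the law of a Markov chain, and vertex-invariance is exactly
what provides its transition law.

Let `ν` be invariant. Applied to paths whose first edge lies in a Borel set on which `s` is
injective, invariance says that the first edge has law `s^*(r_*ν)` on the paths of positive length
(`IsInvariant.measure_edge_preimage`). The range of such a path is that of its first edge, so `∫ f ∘
r d s^*(r_*ν)` is the integral of `f ∘ r` over the paths of positive length only. This is at most `∫
f d(r_*ν)`, with equality if `f` is supported in the regular vertices, because paths of length zero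
are singular vertices.

Uniqueness comes from the same peeling: the measure of a cylinder prescribing `n + 1` edges is a sum
of measures of cylinders prescribing `n` edges (`IsInvariant.measure_cylinder_succ`). By induction
`r_*ν` determines `ν` on a generating π-system.

For existence, given `μ`, one has `r_* s^*μ ≤ μ`, and the difference `m` is null on regular vertices
(`IsVertexInvariant.exists_map_pullback_add_eq`). Hence the law of `(r(e), e)` under `s^*μ`,
together with `m` for stopping at once, has first marginal `μ`. Disintegrating it gives a random
rule `g v u` for the next edge, with `u` uniform. The rule is iterated from initial distribution `μ`
with independent `u`'s. After a first edge `e` the path continues as a fresh one from `s(e)`; this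
self-similarity (`lintegral_randomPathLaw_eq_add`) shows both that almost every edge sequence is a
boundary path and that the law is invariant.

The topological input is the closed embedding `truncations` of the boundary path space into the
product of `V` with the one-point compactifications of the path spaces. It makes the boundary path
space locally compact and Polish and `range` proper, so that measures finite on compact sets are
regular, and by Lusin–Souslin measures can be transported along `code`. -/

instance OnePoint.secondCountableTopology {X : Type*} [TopologicalSpace X] [T2Space X]
    [LocallyCompactSpace X] [SecondCountableTopology X] :
    SecondCountableTopology (OnePoint X) := by
  let K := CompactExhaustion.choice X
  refine (isTopologicalBasis_of_isOpen_of_nhds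
    (s := (fun U : Set X => ((↑) '' U : Set (OnePoint X))) '' countableBasis X ∪
      range fun n => ((↑) '' K n : Set (OnePoint X))ᶜ) ?_ ?_).secondCountableTopology
    (((countable_countableBasis X).image _).union (countable_range _))
  · rintro _ (⟨U, hU, rfl⟩ | ⟨n, rfl⟩)
    · exact OnePoint.isOpen_image_coe.2 (isOpen_of_mem_countableBasis hU)
    · exact OnePoint.isOpen_compl_image_coe.2 ⟨(K.isCompact n).isClosed, K.isCompact n⟩
  · intro a u ha hu
    induction a using OnePoint.rec with
    | infty =>
      obtain ⟨n, hn⟩ := K.exists_superset_of_isCompact ((OnePoint.isOpen_iff_of_mem ha).1 hu).2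
      refine ⟨_, Or.inr ⟨n, rfl⟩, by simp, fun y hy => ?_⟩
      induction y using OnePoint.rec with
      | infty => exact ha
      | coe y =>
        by_contra h
        exact hy ⟨y, hn h, rfl⟩
    | coe x =>
      obtain ⟨U, hU, hxU, hUu⟩ := (isBasis_countableBasis X).exists_subset_of_mem_open
        (show x ∈ ((↑) : X → OnePoint X) ⁻¹' u from ha) (hu.preimage OnePoint.continuous_coe)
      exact ⟨_, Or.inl ⟨U, hU, rfl⟩, ⟨x, hxU, rfl⟩, image_subset_iff.2 hUu⟩

theorem PolishSpace.of_compact {X : Type*} [TopologicalSpace X] [T2Space X]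
    [CompactSpace X] [SecondCountableTopology X] : PolishSpace X := by
  let := metrizableSpaceMetric X
  infer_instance

/-- `X` is open in its compact metrizable one-point compactification. Polishness is what makes
injective Borel images Borel further on. -/
theorem PolishSpace.of_locallyCompact {X : Type*} [TopologicalSpace X] [T2Space X]
    [LocallyCompactSpace X] [SecondCountableTopology X] : PolishSpace X := by
  have := PolishSpace.of_compact (X := OnePoint X)
  have h := (OnePoint.isOpenEmbedding_coe (X := X)).isOpen_range.polishSpace
  exact (OnePoint.isOpenEmbedding_coe (X := X)).toHomeomorph.isClosedEmbedding.polishSpace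

/-- The graph of a continuous partial function is closed. -/
theorem isClosed_setOf_eq_of_eq_coe {X Y : Type*} [TopologicalSpace X] [TopologicalSpace Y]
    [T2Space Y] {f : X → Y} (hf : Continuous f) :
    IsClosed {z : Y × OnePoint X | ∀ p : X, z.2 = p → z.1 = f p} := by
  have h : {z : Y × OnePoint X | ∀ p : X, z.2 = p → z.1 = f p}ᶜ =
      Prod.map id ((↑) : X → OnePoint X) '' {z : Y × X | z.1 ≠ f z.2} := by
    ext ⟨a, b⟩
    simp only [mem_compl_iff, mem_ofPred_eq, not_forall, mem_image, Prod.exists, Prod.map_apply, id,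
      Prod.mk.injEq]
    constructor
    · rintro ⟨p, rfl, h⟩
      exact ⟨a, p, h, rfl, rfl⟩
    · rintro ⟨_, p, h, rfl, rfl⟩
      exact ⟨p, rfl, h⟩
  rw [← isOpen_compl_iff, h]
  refine (IsOpenEmbedding.id.prodMap OnePoint.isOpenEmbedding_coe).isOpenMap _ ?_
  exact isOpen_ne_fun continuous_fst (hf.comp continuous_snd)

/-- The graph of a continuous partial function stays closed after adding the points `(a, ∞)` with
`a ∈ S`, provided that each point outside `S` has a neighbourhood with relatively compact
preimage. -/
theorem isClosed_graph_union {X Y : Type*} [TopologicalSpace X] [T2Space X] [TopologicalSpace Y]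
    [T2Space Y] {f : X → Y} (hf : Continuous f) {S : Set Y}
    (hS : ∀ a ∉ S, ∃ N : Set Y, IsOpen N ∧ a ∈ N ∧ N ⊆ Sᶜ ∧
      ∃ K : Set X, IsCompact K ∧ f ⁻¹' N ⊆ K) :
    IsClosed {z : Y × OnePoint X |
      (∀ p : X, z.2 = p → z.1 = f p) ∧ (z.2 = OnePoint.infty → z.1 ∈ S)} := by
  rw [← isOpen_compl_iff, isOpen_iff_mem_nhds]
  rintro ⟨a, b⟩ hab
  by_cases h : ∀ p : X, b = p → a = f p
  · have h2 : b = OnePoint.infty ∧ a ∉ S := by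
      by_contra hcon
      exact hab ⟨h, fun hb => by_contra fun ha => hcon ⟨hb, ha⟩⟩
    obtain ⟨rfl, ha⟩ := h2
    obtain ⟨N, hN, haN, hNS, K, hK, hfK⟩ := hS a ha
    -- In this neighbourhood of `(a, ∞)`, a graph point `(f p, p)` would have `f p ∈ N`, hence `p ∈
    -- K`, which has been removed; a point over `∞` would lie in `S`, which `N` avoids.
    have hO : IsOpen (N ×ˢ ((↑) '' K : Set (OnePoint X))ᶜ) :=
      hN.prod (OnePoint.isOpen_compl_image_coe.2 ⟨hK.isClosed, hK⟩)
    refine Filter.mem_of_superset (hO.mem_nhds ⟨haN, by simp⟩) ?_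
    rintro ⟨a', b'⟩ ⟨ha', hb'⟩ ⟨h1, h2⟩
    induction b' using OnePoint.rec with
    | infty => exact hNS ha' (h2 rfl)
    | coe p => exact hb' ⟨p, hfK (by rw [mem_preimage, ← h1 p rfl]; exact ha'), rfl⟩
  · refine Filter.mem_of_superset
      ((isClosed_setOf_eq_of_eq_coe hf).isOpen_compl.mem_nhds h) ?_
    exact compl_subset_compl.2 fun z hz => hz.1

end GeneralTopology

/-! ### Borel structure of disjoint unions and countable partitions -/

instance Sum.borelSpace {X Y : Type*} [TopologicalSpace X] [MeasurableSpace X] [BorelSpace X]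
    [TopologicalSpace Y] [MeasurableSpace Y] [BorelSpace Y] : BorelSpace (X ⊕ Y) := by
  refine ⟨le_antisymm (fun s hs => ?_) ?_⟩
  · have h : s = Sum.inl '' (Sum.inl ⁻¹' s) ∪ Sum.inr '' (Sum.inr ⁻¹' s) := by
      ext (x | x) <;> simp
    let : MeasurableSpace (X ⊕ Y) := borel _
    have : BorelSpace (X ⊕ Y) := ⟨rfl⟩
    rw [h]
    exact (IsOpenEmbedding.inl.measurableEmbedding.measurableSet_image.2 hs.1).union
      (IsOpenEmbedding.inr.measurableEmbedding.measurableSet_image.2 hs.2)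
  · refine MeasurableSpace.generateFrom_le fun s hs => measurableSet_sum_iff.2 ⟨?_, ?_⟩
    · exact (hs.preimage continuous_inl).measurableSet
    · exact (hs.preimage continuous_inr).measurableSet

theorem measurable_sumElim_prod {X Y Z W : Type*} [MeasurableSpace X] [MeasurableSpace Y]
    [MeasurableSpace Z] [MeasurableSpace W] {f : Z × X → W} {g : Z × Y → W} (hf : Measurable f)
    (hg : Measurable g) :
    Measurable fun z : Z × (X ⊕ Y) =>
      Sum.elim (fun x => f (z.1, x)) (fun y => g (z.1, y)) z.2 := by
  have h : (fun z : Z × (X ⊕ Y) => Sum.elim (fun x => f (z.1, x)) (fun y => g (z.1, y)) z.2) =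
      Sum.elim f g ∘ MeasurableEquiv.prodSumDistrib Z X Y := by
    ext ⟨z, x | y⟩ <;> rfl
  rw [h]
  exact (hf.sumElim hg).comp (MeasurableEquiv.measurable _)

theorem measurable_sum_unit {X Y : Type*} [MeasurableSpace X] [MeasurableSpace Y]
    {f : Y → X ⊕ Unit} (hf : ∀ B : Set X, MeasurableSet B → MeasurableSet (f ⁻¹' (Sum.inl '' B))) :
    Measurable f := by
  intro S hS
  have hS1 := hf _ (measurableSet_sum_iff.1 hS).1
  by_cases hS2 : Sum.inr () ∈ S
  · have h3 : S = Sum.inl '' (Sum.inl ⁻¹' S) ∪ (Sum.inl '' univ)ᶜ := by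
      ext (e | u) <;> simp [hS2]
    rw [h3, preimage_union, preimage_compl]
    exact hS1.union (hf _ MeasurableSet.univ).compl
  · have h3 : S = Sum.inl '' (Sum.inl ⁻¹' S) := by
      ext (e | u) <;> simp [hS2]
    rwa [h3]

/-- Measures of unions over a countable partition. -/
theorem measure_eq_tsum_of_partition {X E : Type*} [MeasurableSpace X]
    [MeasurableSpace E] (m : Measure X)
    {D : ℕ → Set E} (hD : ∀ n, MeasurableSet (D n)) (hdisj : Pairwise (Function.onFun Disjoint D))
    (hcov : ⋃ n, D n = univ) {f : X → E ⊕ Unit} (hf : Measurable f) {B : Set E}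
    (hB : MeasurableSet B) {S : Set X} (hS : MeasurableSet S) :
    m (f ⁻¹' (Sum.inl '' B) ∩ S) = ∑' n, m (f ⁻¹' (Sum.inl '' (B ∩ D n)) ∩ S) := by
  rw [← measure_iUnion]
  · rw [← iUnion_inter, ← preimage_iUnion, ← image_iUnion, ← inter_iUnion, hcov, inter_univ]
  · intro i j hij
    refine Disjoint.inter_left _ (Disjoint.inter_right _ (Disjoint.preimage _ ?_))
    exact (disjoint_image_iff Sum.inl_injective).2
      ((hdisj hij).mono inter_subset_right inter_subset_right)
  · intro n
    exact (hf (measurableSet_inl_image.2 (hB.inter (hD n)))).inter hS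

/-! ### Boundary paths as edge sequences -/

namespace TopologicalGraph

variable {V E : Type*}
  [TopologicalSpace V] [T2Space V] [LocallyCompactSpace V]
  [TopologicalSpace E] [T2Space E] [LocallyCompactSpace E]
  {G : TopologicalGraph V E}

namespace BoundaryPath

/-- The `n`-th edge of a boundary path, with a dummy value beyond its length. -/
def edge : G.BoundaryPath → ℕ → E ⊕ Unit
  | fin (Sum.inl _) _, _ => Sum.inr ()
  | fin (Sum.inr ⟨m, α⟩) _, n =>
      if h : n ≤ m then Sum.inl (α.1 ⟨n, Nat.lt_succ_of_le h⟩) else Sum.inr ()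
  | inf α, n => Sum.inl (α.1 n)

/-- A boundary path, encoded as its range together with the sequence of its edges. -/
def code (α : G.BoundaryPath) : V × (ℕ → E ⊕ Unit) := (α.range, α.edge)

open Classical in
/-- The initial segment with `n + 1` edges, or `∞` if the path is too short. -/
noncomputable def truncation (n : ℕ) : G.BoundaryPath → OnePoint (G.EdgePath n)
  | fin (Sum.inl _) _ => OnePoint.infty
  | fin (Sum.inr ⟨m, α⟩) _ => if h : n ≤ m then (α.take n h : G.EdgePath n) else OnePoint.infty
  | inf α => (InfPath.take α n : G.EdgePath n)

theorem truncation_eq_coe_iff {n : ℕ} {α : G.BoundaryPath} {p : G.EdgePath n} :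
    α.truncation n = p ↔ ∀ i : Fin (n + 1), α.edge i = Sum.inl (p.1 i) := by
  rcases α with ⟨v | ⟨m, α⟩, h⟩ | α
  · simp [truncation, edge]
  · by_cases hnm : n ≤ m
    · simp only [truncation, edge, hnm, dif_pos, OnePoint.coe_eq_coe, Subtype.ext_iff, funext_iff]
      refine forall_congr' fun i => ?_
      rw [dif_pos ((Nat.lt_succ_iff.1 i.2).trans hnm), Sum.inl.injEq]
      rfl
    · simp only [truncation, edge, hnm, dif_neg, not_false_iff]
      refine ⟨fun h => absurd h (OnePoint.infty_ne_coe _), fun h => ?_⟩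
      have := h (Fin.last n)
      simp [hnm] at this
  · simp only [truncation, edge, OnePoint.coe_eq_coe, Subtype.ext_iff, funext_iff, Sum.inl.injEq]
    rfl

theorem truncation_eq_infty_iff {n : ℕ} {α : G.BoundaryPath} :
    α.truncation n = OnePoint.infty ↔ α.edge n = Sum.inr () := by
  rcases α with ⟨v | ⟨m, α⟩, h⟩ | α
  · simp [truncation, edge]
  · by_cases hnm : n ≤ m <;> simp [truncation, edge, hnm]
  · simp [truncation, edge]

theorem mem_initialSegments_iff {α : G.BoundaryPath} {β : G.FinPath} :
    β ∈ α.initialSegments ↔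
      ∃ (n : ℕ) (p : G.EdgePath n), α.truncation n = p ∧ β = Sum.inr ⟨n, p⟩ := by
  rcases α with ⟨v | ⟨m, α⟩, h⟩ | α
  · simp [truncation, initialSegments]
  · constructor
    · rintro ⟨n, hn, rfl⟩
      exact ⟨n, _, dif_pos hn, rfl⟩
    · rintro ⟨n, p, hp, rfl⟩
      by_cases hn : n ≤ m
      · refine ⟨n, hn, ?_⟩
        simp only [truncation, hn, dif_pos, OnePoint.coe_eq_coe] at hp
        rw [hp]
      · simp [truncation, hn] at hp
  · constructor
    · rintro ⟨n, rfl⟩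
      exact ⟨n, _, rfl, rfl⟩
    · rintro ⟨n, p, hp, rfl⟩
      refine ⟨n, ?_⟩
      simp only [truncation, OnePoint.coe_eq_coe] at hp
      rw [hp]

theorem mem_Z_iff {α : G.BoundaryPath} {S : Set G.FinPath} :
    α ∈ Z S ↔ Sum.inl α.range ∈ S ∨
      ∃ (n : ℕ) (p : G.EdgePath n), α.truncation n = p ∧ Sum.inr ⟨n, p⟩ ∈ S := by
  simp only [Z, mem_ofPred_eq, mem_initialSegments_iff]
  refine or_congr Iff.rfl ⟨?_, ?_⟩
  · rintro ⟨_, ⟨n, p, hp, rfl⟩, h⟩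
    exact ⟨n, p, hp, h⟩
  · rintro ⟨n, p, hp, h⟩
    exact ⟨_, ⟨n, p, hp, rfl⟩, h⟩

theorem code_injective : Function.Injective (code : G.BoundaryPath → V × (ℕ → E ⊕ Unit)) := by
  intro α β h
  have hr : α.range = β.range := congrArg Prod.fst h
  have he : ∀ n, α.edge n = β.edge n := congrFun (congrArg Prod.snd h)
  rcases α with ⟨v | ⟨m, α⟩, hα⟩ | α <;> rcases β with ⟨w | ⟨k, β⟩, hβ⟩ | β
  · obtain rfl : v = w := hr
    rfl
  · simpa [edge] using he 0
  · simpa [edge] using he 0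
  · simpa [edge] using he 0
  · obtain rfl : m = k := by
      refine le_antisymm (not_lt.1 fun hlt => ?_) (not_lt.1 fun hlt => ?_)
      · simpa [edge, hlt.not_ge] using he m
      · simpa [edge, hlt.not_ge] using he k
    obtain rfl : α = β := by
      refine Subtype.ext (funext fun i => ?_)
      simpa [edge, Nat.lt_succ_iff.1 i.2] using he i
    rfl
  · simpa [edge] using he (m + 1)
  · simpa [edge] using he 0
  · simpa [edge] using he (k + 1)
  · obtain rfl : α = β := Subtype.ext (funext fun i => by simpa [edge] using he i)
    rfl

theorem isVertex_iff {α : G.BoundaryPath} : α.IsVertex ↔ α.edge 0 = Sum.inr () := by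
  rcases α with ⟨v | ⟨m, α⟩, h⟩ | α <;> simp [IsVertex, edge]

end BoundaryPath

variable (G) in
/-- Encoded paths: range and edges match, consecutive edges are composable, and the path terminates
only, and forever, at singular vertices. -/
structure IsPathCode (x : V × (ℕ → E ⊕ Unit)) : Prop where
  range_eq : ∀ e, x.2 0 = Sum.inl e → G.r e = x.1
  comp : ∀ n e e', x.2 n = Sum.inl e → x.2 (n + 1) = Sum.inl e' → G.s e = G.r e'
  ends : ∀ n, x.2 n = Sum.inr () → x.2 (n + 1) = Sum.inr ()
  singular_zero : x.2 0 = Sum.inr () → x.1 ∈ G.singularVertices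
  singular_succ : ∀ n e, x.2 n = Sum.inl e → x.2 (n + 1) = Sum.inr () →
    G.s e ∈ G.singularVertices

namespace BoundaryPath

theorem isPathCode_code (α : G.BoundaryPath) : G.IsPathCode α.code := by
  rcases α with ⟨v | ⟨m, α⟩, h⟩ | α
  · constructor <;> simp [code, edge]
    exact h
  · refine ⟨?_, ?_, ?_, ?_, ?_⟩
    · simp [code, edge, range]
    · intro n e e' h1 h2
      simp only [code, edge] at h1 h2
      split_ifs at h1 h2 with h3 h4
      obtain rfl := Sum.inl.inj h1
      obtain rfl := Sum.inl.inj h2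
      exact α.2 ⟨n, h4⟩
    · intro n h1
      simp only [code, edge] at h1 ⊢
      split_ifs at h1 with h3
      rw [dif_neg fun h4 => h3 ((Nat.le_succ n).trans h4)]
    · simp [code, edge]
    · intro n e h1 h2
      simp only [code, edge] at h1 h2
      split_ifs at h1 h2 with h3 h4
      obtain rfl := Sum.inl.inj h1
      obtain rfl : n = m := by omega
      exact h
  · constructor <;> simp [code, edge, range, α.2]

/-- A code that never takes the dummy value is an infinite path. Otherwise the least index with the
dummy value is the length, `ends` keeps the dummy value from there on, and the two singularity
clauses supply the condition on the source. -/
theorem exists_code_eq {x : V × (ℕ → E ⊕ Unit)} (hx : G.IsPathCode x) :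
    ∃ α : G.BoundaryPath, α.code = x := by
  obtain ⟨v, x⟩ := x
  by_cases hinf : ∀ n, ∃ e, x n = Sum.inl e
  · choose y hy using hinf
    refine ⟨inf ⟨y, fun i => hx.comp i _ _ (hy i) (hy (i + 1))⟩, ?_⟩
    refine Prod.ext (hx.range_eq _ (hy 0)) (funext fun n => (hy n).symm)
  · have hex : ∃ n, x n = Sum.inr () := by
      simp only [not_forall, not_exists] at hinf
      obtain ⟨n, hn⟩ := hinf
      refine ⟨n, ?_⟩
      rcases hxn : x n with e | u
      · exact absurd hxn (hn e)
      · rfl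
    classical
    have hends : ∀ n, Nat.find hex ≤ n → x n = Sum.inr () := by
      intro n hn
      induction n, hn using Nat.le_induction with
      | base => exact Nat.find_spec hex
      | succ n _ ih => exact hx.ends n ih
    have hgo : ∀ n, n < Nat.find hex → ∃ e, x n = Sum.inl e := by
      intro n hn
      rcases hxn : x n with e | u
      · exact ⟨e, rfl⟩
      · exact absurd hxn (Nat.find_min hex hn)
    generalize Nat.find hex = N at hends hgo
    rcases N with _ | m
    · refine ⟨fin (Sum.inl v) (hx.singular_zero (hends 0 le_rfl)), ?_⟩
      exact Prod.ext rfl (funext fun n => (hends n (Nat.zero_le n)).symm)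
    · choose y hy using fun i : Fin (m + 1) => hgo i i.2
      refine ⟨fin (Sum.inr ⟨m, y, fun i => hx.comp i _ _ (hy i.castSucc) (hy i.succ)⟩)
        (hx.singular_succ m _ (hy (Fin.last m)) (hends _ le_rfl)), ?_⟩
      refine Prod.ext (hx.range_eq _ (hy 0)) (funext fun n => ?_)
      by_cases hn : n ≤ m
      · simpa [code, edge, hn] using (hy ⟨n, Nat.lt_succ_of_le hn⟩).symm
      · simpa [code, edge, hn] using (hends n (by omega)).symm

theorem range_code : Set.range (code : G.BoundaryPath → _) = {x | G.IsPathCode x} :=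
  Subset.antisymm (range_subset_iff.2 isPathCode_code) fun _ hx => exists_code_eq hx

end BoundaryPath

variable (G) in
/-- The shift on encoded paths. -/
def codeShift (x : V × (ℕ → E ⊕ Unit)) : V × (ℕ → E ⊕ Unit) :=
  (Sum.elim G.s (fun _ => x.1) (x.2 0), fun n => x.2 (n + 1))

/-- Prepend an edge to an encoded path. -/
def consCode (G : TopologicalGraph V E) (e : E) (x : ℕ → E ⊕ Unit) : V × (ℕ → E ⊕ Unit) :=
  (G.r e, fun n => Nat.casesOn n (Sum.inl e) x)

theorem codeShift_consCode (e : E) (x : ℕ → E ⊕ Unit) :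
    G.codeShift (G.consCode e x) = (G.s e, x) := rfl

namespace BoundaryPath

theorem code_shift (α : G.BoundaryPath) : α.shift.code = G.codeShift α.code := by
  rcases α with ⟨v | ⟨m, α⟩, h⟩ | α
  · rfl
  · rcases m with _ | m
    · rfl
    · refine Prod.ext (α.2 0).symm (funext fun n => ?_)
      by_cases hn : n ≤ m <;> simp [code, codeShift, edge, shift, hn, EdgePath.tail]
  · exact Prod.ext (α.2 0).symm rfl

theorem eq_consCode {α : G.BoundaryPath} {e : E} (h : α.edge 0 = Sum.inl e) :
    α.code = G.consCode e α.shift.edge := by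
  refine Prod.ext ((isPathCode_code α).range_eq e h).symm (funext fun n => ?_)
  rcases n with _ | n
  · exact h
  · exact (congrFun (congrArg Prod.snd (code_shift α)) n).symm

theorem range_shift {α : G.BoundaryPath} {e : E} (h : α.edge 0 = Sum.inl e) :
    α.shift.range = G.s e := by
  have h2 : α.shift.range = Sum.elim G.s _ (α.edge 0) := congrArg Prod.fst (code_shift α)
  rw [h2, h, Sum.elim_inl]

/-- Singularity of the source depends only on the end of the path, so prepending a composable edge
stays in the boundary path space, even to a vertex. This makes images under the shift computable. -/
theorem exists_prepend {e : E} {β : G.BoundaryPath} (h : G.s e = β.range) :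
    ∃ α : G.BoundaryPath, α.edge 0 = Sum.inl e ∧ α.shift = β := by
  have hβ := isPathCode_code β
  obtain ⟨α, hα⟩ := exists_code_eq (G := G) (x := G.consCode e β.edge) (by
    refine ⟨?_, ?_, ?_, ?_, ?_⟩
    · rintro e' he'
      obtain rfl := Sum.inl.inj he'
      rfl
    · rintro (_ | n) e' e'' h1 h2
      · obtain rfl := Sum.inl.inj h1
        exact h.trans (hβ.range_eq _ h2).symm
      · exact hβ.comp n _ _ h1 h2
    · rintro (_ | n) h1
      · exact (Sum.inl_ne_inr h1).elim
      · exact hβ.ends n h1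
    · exact fun h1 => (Sum.inl_ne_inr h1).elim
    · rintro (_ | n) e' h1 h2
      · obtain rfl := Sum.inl.inj h1
        rw [h]
        exact hβ.singular_zero h2
      · exact hβ.singular_succ n _ h1 h2)
  refine ⟨α, congrFun (congrArg Prod.snd hα) 0, code_injective ?_⟩
  rw [code_shift, hα, codeShift_consCode, h]
  rfl

end BoundaryPath

end TopologicalGraph

/-! ### Topology of the boundary path space -/

namespace TopologicalGraph

variable {V E : Type*}
  [TopologicalSpace V] [T2Space V] [LocallyCompactSpace V]
  [TopologicalSpace E] [T2Space E] [LocallyCompactSpace E]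
  {G : TopologicalGraph V E}

variable (G) in
theorem isClosedEmbedding_edgePath (n : ℕ) :
    IsClosedEmbedding (Subtype.val : G.EdgePath n → Fin (n + 1) → E) := by
  refine IsClosed.isClosedEmbedding_subtypeVal ?_
  have h : {α : Fin (n + 1) → E | ∀ i : Fin n, G.s (α i.castSucc) = G.r (α i.succ)} =
      ⋂ i : Fin n, {α | G.s (α i.castSucc) = G.r (α i.succ)} := by
    ext; simp
  change IsClosed {α : Fin (n + 1) → E | ∀ i : Fin n, G.s (α i.castSucc) = G.r (α i.succ)}
  rw [h]
  refine isClosed_iInter fun i => isClosed_eq ?_ ?_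
  · exact G.isLocalHomeomorph_s.continuous.comp (continuous_apply _)
  · exact G.continuous_r.comp (continuous_apply _)

instance (n : ℕ) : LocallyCompactSpace (G.EdgePath n) :=
  (G.isClosedEmbedding_edgePath n).locallyCompactSpace

theorem isCompact_setOf_forall_mem {n : ℕ} {M : Fin (n + 1) → Set E} (hM : ∀ i, IsCompact (M i)) :
    IsCompact {α : G.EdgePath n | ∀ i, α.1 i ∈ M i} := by
  have h := (G.isClosedEmbedding_edgePath n).isCompact_preimage (isCompact_univ_pi hM)
  simpa [Set.pi, preimage] using h

theorem EdgePath.continuous_take (n : ℕ) :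
    Continuous fun α : G.EdgePath (n + 1) => α.take n (Nat.le_succ n) :=
  continuous_induced_rng.2 (continuous_pi fun i =>
    (continuous_apply i.castSucc).comp continuous_subtype_val)

variable (G) in
theorem isOpen_regularVertices : IsOpen G.regularVertices := by
  rw [isOpen_iff_mem_nhds]
  rintro v ⟨W, hW, hv, h⟩
  exact Filter.mem_of_superset (hW.mem_nhds hv) fun w hw => ⟨W, hW, hw, h⟩

/-- The length is a continuous map to a discrete space. Finiteness makes `Z K` a finite union of
closed sets in `isInducing_truncations`. -/
theorem finite_setOf_exists_mem {K : Set G.FinPath} (hK : IsCompact K) :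
    {n : ℕ | ∃ p : G.EdgePath n, Sum.inr ⟨n, p⟩ ∈ K}.Finite := by
  let f : G.FinPath → ℕ := Sum.elim (fun _ => 0) Sigma.fst
  have hf : Continuous f := continuous_const.sumElim
    (continuous_sigma fun n => continuous_const)
  refine (hK.image hf).finite_of_discrete.subset ?_
  rintro n ⟨p, hp⟩
  exact ⟨_, hp, rfl⟩

theorem isClosedEmbedding_inr_mk (n : ℕ) :
    IsClosedEmbedding (fun p : G.EdgePath n => (Sum.inr ⟨n, p⟩ : G.FinPath)) :=
  IsClosedEmbedding.inr.comp IsClosedEmbedding.sigmaMk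

theorem isOpenEmbedding_inr_mk (n : ℕ) :
    IsOpenEmbedding (fun p : G.EdgePath n => (Sum.inr ⟨n, p⟩ : G.FinPath)) :=
  IsOpenEmbedding.inr.comp IsOpenEmbedding.sigmaMk

namespace BoundaryPath

theorem isOpen_Z {U : Set G.FinPath} (hU : IsOpen U) : IsOpen (Z U : Set G.BoundaryPath) := by
  refine isOpen_generateFrom_of_mem ⟨U, ∅, hU, isCompact_empty, ?_⟩
  simp [Z]

theorem isClosed_Z {K : Set G.FinPath} (hK : IsCompact K) :
    IsClosed (Z K : Set G.BoundaryPath) := by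
  rw [← isOpen_compl_iff]
  refine isOpen_generateFrom_of_mem ⟨univ, K, isOpen_univ, hK, ?_⟩
  simp [Z, Set.compl_eq_univ_sdiff]

theorem Z_image_inr_mk {n : ℕ} (S : Set (G.EdgePath n)) :
    Z ((fun p : G.EdgePath n => (Sum.inr ⟨n, p⟩ : G.FinPath)) '' S) =
      truncation n ⁻¹' ((↑) '' S : Set (OnePoint (G.EdgePath n))) := by
  ext α
  simp only [mem_Z_iff, mem_image, mem_preimage, reduceCtorEq, and_false, exists_false, false_or]
  constructor
  · rintro ⟨m, p, hp, q, hq, h⟩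
    cases h
    exact ⟨q, hq, hp.symm⟩
  · rintro ⟨q, hq, h⟩
    exact ⟨n, q, h.symm, q, hq, rfl⟩

/-- Open sets of the one-point compactification are the open sets of paths and the complements of
compact ones; they pull back to some `Z U` with `U` open or to the complement of some `Z K` with `K`
compact. -/
theorem continuous_truncation (n : ℕ) :
    Continuous (truncation n : G.BoundaryPath → OnePoint (G.EdgePath n)) := by
  refine ⟨fun O hO => ?_⟩
  by_cases h : OnePoint.infty ∈ O
  · obtain ⟨h1, h2⟩ := (OnePoint.isOpen_iff_of_mem h).1 hO
    have h3 : truncation n ⁻¹' O = (Z ((fun p : G.EdgePath n => (Sum.inr ⟨n, p⟩ : G.FinPath)) ''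
        ((↑) ⁻¹' O)ᶜ) : Set G.BoundaryPath)ᶜ := by
      rw [Z_image_inr_mk, ← preimage_compl]
      congr 1
      ext y
      induction y using OnePoint.rec <;> simp [h]
    rw [h3, isOpen_compl_iff]
    exact isClosed_Z (h2.image (isClosedEmbedding_inr_mk n).continuous)
  · have h3 : truncation n ⁻¹' O = (Z ((fun p : G.EdgePath n => (Sum.inr ⟨n, p⟩ : G.FinPath)) ''
        ((↑) ⁻¹' O)) : Set G.BoundaryPath) := by
      rw [Z_image_inr_mk]
      congr 1
      ext y
      induction y using OnePoint.rec <;> simp [h]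
    rw [h3]
    exact isOpen_Z ((isOpenEmbedding_inr_mk n).isOpenMap _ (hO.preimage OnePoint.continuous_coe))

/-- A boundary path, encoded as its range together with all its truncations. -/
noncomputable def truncations (α : G.BoundaryPath) : V × (∀ n, OnePoint (G.EdgePath n)) :=
  (α.range, fun n => α.truncation n)

theorem continuous_truncations :
    Continuous (truncations : G.BoundaryPath → V × (∀ n, OnePoint (G.EdgePath n))) :=
  continuous_range.prodMk (continuous_pi continuous_truncation)

theorem Z_eq_union (S : Set G.FinPath) : (Z S : Set G.BoundaryPath) =
    range ⁻¹' (Sum.inl ⁻¹' S) ∪ ⋃ n ∈ {n : ℕ | ∃ p : G.EdgePath n, Sum.inr ⟨n, p⟩ ∈ S},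
      truncation n ⁻¹' ((↑) '' {p : G.EdgePath n | Sum.inr ⟨n, p⟩ ∈ S}) := by
  ext α
  simp only [mem_Z_iff, mem_union, mem_preimage, mem_iUnion, mem_image, mem_ofPred_eq]
  refine or_congr Iff.rfl ⟨?_, ?_⟩
  · rintro ⟨n, p, hp, h⟩
    exact ⟨n, ⟨p, h⟩, p, h, hp.symm⟩
  · rintro ⟨n, -, p, h, hp⟩
    exact ⟨n, p, hp.symm, h⟩

theorem isInducing_truncations :
    IsInducing (truncations : G.BoundaryPath → V × (∀ n, OnePoint (G.EdgePath n))) := by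
  refine ⟨le_antisymm continuous_truncations.le_induced ?_⟩
  refine le_generateFrom ?_
  rintro _ ⟨U, K, hU, hK, rfl⟩
  let t : TopologicalSpace G.BoundaryPath := induced truncations inferInstance
  have h0 : Continuous (truncations : G.BoundaryPath → V × (∀ n, OnePoint (G.EdgePath n))) :=
    continuous_induced_dom
  have hr : Continuous (range : G.BoundaryPath → V) := continuous_fst.comp h0
  have ht : ∀ n, Continuous (truncation n : G.BoundaryPath → OnePoint (G.EdgePath n)) :=
    fun n => (continuous_apply n).comp (continuous_snd.comp h0)
  refine IsOpen.sdiff ?_ ?_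
  · rw [Z_eq_union]
    refine ((hU.preimage continuous_inl).preimage hr).union (isOpen_biUnion fun n _ => ?_)
    refine IsOpen.preimage (ht n) (OnePoint.isOpen_image_coe.2 ?_)
    exact hU.preimage (isOpenEmbedding_inr_mk n).continuous
  · rw [Z_eq_union]
    refine (IsClosed.preimage hr (hK.isClosed.preimage continuous_inl)).union
      ((finite_setOf_exists_mem hK).isClosed_biUnion fun n _ => ?_)
    refine IsClosed.preimage (ht n) (OnePoint.isClosed_image_coe.2 ?_)
    have h := (isClosedEmbedding_inr_mk n).isCompact_preimage hK
    exact ⟨h.isClosed, h⟩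

theorem truncations_injective :
    Function.Injective (truncations : G.BoundaryPath → V × (∀ n, OnePoint (G.EdgePath n))) := by
  intro α β h
  have ht : ∀ n, α.truncation n = β.truncation n := congrFun (congrArg Prod.snd h)
  refine code_injective (Prod.ext (congrArg Prod.fst h :) (funext fun n => ?_))
  change α.edge n = β.edge n
  rcases hn : α.truncation n with _ | p
  · rw [truncation_eq_infty_iff.1 hn, truncation_eq_infty_iff.1 ((ht n).symm.trans hn)]
  · have h1 : α.edge n = _ := truncation_eq_coe_iff.1 hn (Fin.last n)
    have h2 : β.edge n = _ := truncation_eq_coe_iff.1 ((ht n).symm.trans hn) (Fin.last n)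
    rw [h1, h2]

/-- The last edge of a truncation. -/
def lastEdge {n : ℕ} (y : OnePoint (G.EdgePath n)) : E ⊕ Unit :=
  y.elim (Sum.inr ()) fun p => Sum.inl (p.1 (Fin.last n))

/-- Each condition links only two coordinates, either the range and truncation `0` or truncations
`n` and `n + 1`, and has the shape treated by `isClosed_graph_union`. -/
theorem range_truncations :
    Set.range (truncations : G.BoundaryPath → V × (∀ n, OnePoint (G.EdgePath n))) =
      {z | (∀ p : G.EdgePath 0, z.2 0 = ↑p → z.1 = G.r (p.1 0)) ∧
        (z.2 0 = OnePoint.infty → z.1 ∈ G.singularVertices)} ∩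
      ⋂ n, {z | (∀ q : G.EdgePath (n + 1), z.2 (n + 1) = ↑q →
          z.2 n = ((q.take n (Nat.le_succ n) : G.EdgePath n) : OnePoint (G.EdgePath n))) ∧
        (z.2 (n + 1) = OnePoint.infty →
          z.2 n ∈ {y | ∀ p : G.EdgePath n, y = ↑p → G.s (p.1 (Fin.last n)) ∈ G.singularVertices})} := by
  refine Subset.antisymm (range_subset_iff.2 fun α => ?_) fun z hz => ?_
  · have hα := isPathCode_code α
    refine ⟨⟨fun p hp => ?_, fun h => ?_⟩, mem_iInter.2 fun n => ⟨fun q hq => ?_, fun h p hp => ?_⟩⟩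
    · exact (hα.range_eq _ (truncation_eq_coe_iff.1 hp 0)).symm
    · exact hα.singular_zero (truncation_eq_infty_iff.1 h)
    · exact truncation_eq_coe_iff.2 fun i => truncation_eq_coe_iff.1 hq i.castSucc
    · exact hα.singular_succ n _ (truncation_eq_coe_iff.1 hp (Fin.last n))
        (truncation_eq_infty_iff.1 h)
  · obtain ⟨v, y⟩ := z
    obtain ⟨⟨h1, h2⟩, h3⟩ := hz
    have h4 : ∀ n (q : G.EdgePath (n + 1)), y (n + 1) = ↑q →
        y n = ((q.take n (Nat.le_succ n) : G.EdgePath n) : OnePoint (G.EdgePath n)) := fun n => (mem_iInter.1 h3 n).1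
    have h5 : ∀ n, y (n + 1) = OnePoint.infty → ∀ p : G.EdgePath n, y n = ↑p →
        G.s (p.1 (Fin.last n)) ∈ G.singularVertices := fun n => (mem_iInter.1 h3 n).2
    have hinl : ∀ n e, lastEdge (y n) = Sum.inl e →
        ∃ p : G.EdgePath n, y n = ↑p ∧ p.1 (Fin.last n) = e := by
      intro n e h
      rcases hn : y n with _ | p
      · rw [hn] at h
        exact (Sum.inr_ne_inl h).elim
      · rw [hn] at h
        exact ⟨p, rfl, Sum.inl.inj h⟩
    have hinr : ∀ n, lastEdge (y n) = Sum.inr () → y n = OnePoint.infty := by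
      intro n h
      rcases hn : y n with _ | p
      · rfl
      · rw [hn] at h
        exact (Sum.inl_ne_inr h).elim
    obtain ⟨α, hα⟩ := exists_code_eq (G := G) (x := (v, fun n => lastEdge (y n))) (by
      refine ⟨?_, ?_, ?_, ?_, ?_⟩
      · intro e he
        obtain ⟨p, hp, rfl⟩ := hinl _ _ he
        exact (h1 p hp).symm
      · intro n e e' he he'
        obtain ⟨p, hp, rfl⟩ := hinl _ _ he
        obtain ⟨q, hq, rfl⟩ := hinl _ _ he'
        have h := OnePoint.coe_injective ((h4 n q hq).symm.trans hp)
        rw [← h]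
        exact q.2 (Fin.last n)
      · intro n hn
        rcases hn' : y (n + 1) with _ | q
        · simp only [hn']
          rfl
        · have h := (hinr n hn).symm.trans (h4 n q hn')
          exact absurd h (OnePoint.infty_ne_coe _)
      · exact fun h => h2 (hinr 0 h)
      · intro n e he h
        obtain ⟨p, hp, rfl⟩ := hinl _ _ he
        exact h5 n (hinr _ h) p hp)
    refine ⟨α, Prod.ext (congrArg Prod.fst hα :) (funext fun n => ?_)⟩
    have hedge : ∀ n, α.edge n = lastEdge (y n) := congrFun (congrArg Prod.snd hα)
    change α.truncation n = y n
    rcases hn : y n with _ | p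
    · refine truncation_eq_infty_iff.2 ?_
      rw [hedge, hn]
      rfl
    · refine truncation_eq_coe_iff.2 ?_
      -- A nontrivial truncation determines all shorter ones by `h4`, so induction on `n` recovers
      -- every edge of `p`, not only the last.
      have key : ∀ n (p : G.EdgePath n), y n = ↑p → ∀ i : Fin (n + 1),
          lastEdge (y i) = Sum.inl (p.1 i) := by
        intro n
        induction n with
        | zero =>
          intro p hp i
          obtain rfl := Fin.fin_one_eq_zero i
          simp only [Fin.val_zero, hp]
          rfl
        | succ n ih =>
          intro p hp i
          induction i using Fin.lastCases with
          | last =>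
            simp only [Fin.val_last, hp]
            rfl
          | cast i => exact ih _ (h4 n p hp) i
      intro i
      rw [hedge]
      exact key n p hn i

/-- Closedness of the range is where regularity enters. If a path ends at a regular vertex, its
one-edge extensions, and those of nearby paths, have their last edge in the compact set `r⁻¹(closure
W)`. They therefore cannot escape to `∞`, and no limit of boundary paths stops at a regular vertex.
-/
theorem isClosedEmbedding_truncations :
    IsClosedEmbedding (truncations : G.BoundaryPath → V × (∀ n, OnePoint (G.EdgePath n))) := by
  refine ⟨⟨isInducing_truncations, truncations_injective⟩, ?_⟩
  rw [range_truncations]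
  have hlast : ∀ n, Continuous fun p : G.EdgePath n => p.1 (Fin.last n) := fun n =>
    (continuous_apply _).comp continuous_subtype_val
  refine IsClosed.inter ?_ (isClosed_iInter fun n => ?_)
  · refine IsClosed.preimage (f := fun z : V × (∀ n, OnePoint (G.EdgePath n)) => (z.1, z.2 0))
      (continuous_fst.prodMk ((continuous_apply 0).comp continuous_snd))
      (isClosed_graph_union (G.continuous_r.comp ((continuous_apply 0).comp continuous_subtype_val))
        fun a ha => ?_)
    obtain ⟨W, hW, haW, hW1, hW2, hW3⟩ := not_not.1 ha
    refine ⟨W, hW, haW, fun w hw => not_not.2 ⟨W, hW, hw, hW1, hW2, hW3⟩, _,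
      isCompact_setOf_forall_mem (fun _ => hW2), fun p hp i => ?_⟩
    obtain rfl := Fin.fin_one_eq_zero i
    exact subset_closure hp
  · refine IsClosed.preimage
      (f := fun z : V × (∀ n, OnePoint (G.EdgePath n)) => (z.2 n, z.2 (n + 1)))
      (((continuous_apply n).comp continuous_snd).prodMk
        ((continuous_apply (n + 1)).comp continuous_snd))
      (isClosed_graph_union (OnePoint.continuous_coe.comp (EdgePath.continuous_take n))
        fun a ha => ?_)
    simp only [mem_ofPred_eq, not_forall] at ha
    obtain ⟨p, rfl, hp⟩ := ha
    obtain ⟨W, hW, hpW, hW1, hW2, hW3⟩ := not_not.1 hp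
    obtain ⟨K, hK, hpK⟩ := exists_compact_mem_nhds p
    have hsW : IsOpen ((fun q : G.EdgePath n => G.s (q.1 (Fin.last n))) ⁻¹' W) :=
      hW.preimage (G.isLocalHomeomorph_s.continuous.comp (hlast n))
    refine ⟨(↑) '' (interior K ∩ (fun q : G.EdgePath n => G.s (q.1 (Fin.last n))) ⁻¹' W),
      OnePoint.isOpen_image_coe.2 (isOpen_interior.inter hsW),
      ⟨p, ⟨mem_interior_iff_mem_nhds.2 hpK, hpW⟩, rfl⟩, ?_,
      -- This box is compact: the last edge lies in `r⁻¹(closure W)` and each earlier one in the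
      -- corresponding coordinate projection of `K`.
      {q : G.EdgePath (n + 1) | ∀ i, q.1 i ∈ (Fin.lastCases (G.r ⁻¹' closure W)
        (fun i => (fun q : G.EdgePath n => q.1 i) '' K) i : Set E)},
      isCompact_setOf_forall_mem fun i => ?_, ?_⟩
    · rintro _ ⟨q, ⟨-, hq⟩, rfl⟩ h
      exact h q rfl ⟨W, hW, hq, hW1, hW2, hW3⟩
    · induction i using Fin.lastCases with
      | last => simpa using hW2
      | cast i =>
        simpa using hK.image ((continuous_apply i).comp continuous_subtype_val)
    · rintro q ⟨q', ⟨hq1, hq2⟩, hq⟩ i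
      obtain rfl := OnePoint.coe_injective hq
      induction i using Fin.lastCases with
      | last =>
        rw [Fin.lastCases_last]
        have h : G.s (q.1 (Fin.last n).castSucc) = G.r (q.1 (Fin.last (n + 1))) := q.2 (Fin.last n)
        exact subset_closure (h ▸ hq2)
      | cast i =>
        rw [Fin.lastCases_castSucc]
        exact ⟨_, interior_subset hq1, rfl⟩

/-- The remaining factors of the ambient product are compact, so `range` is proper. This gives local
compactness and makes `r_*ν` finite on compact sets. -/
theorem isCompact_range_preimage {K : Set V} (hK : IsCompact K) :
    IsCompact ((range : G.BoundaryPath → V) ⁻¹' K) := by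
  have h := isClosedEmbedding_truncations (G := G).isCompact_preimage (hK.prod isCompact_univ)
  simpa [preimage, truncations] using h

instance : T2Space G.BoundaryPath := isClosedEmbedding_truncations.isEmbedding.t2Space

instance : LocallyCompactSpace G.BoundaryPath := by
  have : WeaklyLocallyCompactSpace G.BoundaryPath := ⟨fun α => by
    obtain ⟨K, hK, h⟩ := exists_compact_mem_nhds α.range
    exact ⟨_, isCompact_range_preimage hK, continuous_range.continuousAt h⟩⟩
  infer_instance

instance [SecondCountableTopology V] [SecondCountableTopology E] :
    SecondCountableTopology G.BoundaryPath :=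
  have (n : ℕ) : SecondCountableTopology (G.EdgePath n) :=
    (G.isClosedEmbedding_edgePath n).isEmbedding.secondCountableTopology
  have (n : ℕ) : SecondCountableTopology (OnePoint (G.EdgePath n)) := inferInstance
  isClosedEmbedding_truncations.isEmbedding.secondCountableTopology

instance [SecondCountableTopology V] [SecondCountableTopology E] : PolishSpace G.BoundaryPath :=
  PolishSpace.of_locallyCompact

theorem measurable_edge [MeasurableSpace E] [BorelSpace E] (n : ℕ) : Measurable fun α : G.BoundaryPath => α.edge n := by
  have h : ∀ U : Set E, IsOpen U →
      MeasurableSet ((fun α : G.BoundaryPath => α.edge n) ⁻¹' (Sum.inl '' U)) := by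
    intro U hU
    have h1 : (fun α : G.BoundaryPath => α.edge n) ⁻¹' (Sum.inl '' U) =
        truncation n ⁻¹' ((↑) '' {p : G.EdgePath n | p.1 (Fin.last n) ∈ U}) := by
      ext α
      constructor
      · rintro ⟨e, he, h⟩
        rcases hα : α.truncation n with _ | p
        · exact (Sum.inl_ne_inr (h.trans (truncation_eq_infty_iff.1 hα))).elim
        · refine ⟨p, ?_, hα.symm⟩
          have h2 : α.edge n = _ := truncation_eq_coe_iff.1 hα (Fin.last n)
          obtain rfl := Sum.inl.inj (h.trans h2)
          exact he
      · rintro ⟨p, hp, h⟩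
        exact ⟨_, hp, (truncation_eq_coe_iff.1 h.symm (Fin.last n)).symm⟩
    rw [h1]
    refine (IsOpen.preimage (continuous_truncation n) (OnePoint.isOpen_image_coe.2 ?_)).measurableSet
    exact hU.preimage ((continuous_apply _).comp continuous_subtype_val)
  refine measurable_of_isOpen fun O hO => ?_
  have hO1 := h _ (hO.preimage continuous_inl)
  by_cases hO2 : Sum.inr () ∈ O
  · have h3 : (fun α : G.BoundaryPath => α.edge n) ⁻¹' O =
        (fun α : G.BoundaryPath => α.edge n) ⁻¹' (Sum.inl '' (Sum.inl ⁻¹' O)) ∪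
          ((fun α : G.BoundaryPath => α.edge n) ⁻¹' (Sum.inl '' univ))ᶜ := by
      rw [← preimage_compl, ← preimage_union]
      congr 1
      ext (e | u) <;> simp [hO2]
    rw [h3]
    exact hO1.union (h _ isOpen_univ).compl
  · have h3 : O = Sum.inl '' (Sum.inl ⁻¹' O) := by
      ext (e | u) <;> simp [hO2]
    rwa [h3]

section Measurability

variable [SecondCountableTopology V] [SecondCountableTopology E]
  [MeasurableSpace V] [BorelSpace V] [MeasurableSpace E] [BorelSpace E]

theorem measurable_code : Measurable (code : G.BoundaryPath → V × (ℕ → E ⊕ Unit)) :=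
  continuous_range.measurable.prodMk (measurable_pi_iff.2 measurable_edge)

/-- Lusin–Souslin: an injective Borel map from a Polish space carries Borel sets to Borel sets.
Measures can thus be built on the product and pulled back. -/
theorem measurableEmbedding_code :
    MeasurableEmbedding (code : G.BoundaryPath → V × (ℕ → E ⊕ Unit)) := by
  have := PolishSpace.of_locallyCompact (X := E)
  have := PolishSpace.of_locallyCompact (X := V)
  have : StandardBorelSpace (ℕ → E ⊕ Unit) := inferInstance
  have : StandardBorelSpace (V × (ℕ → E ⊕ Unit)) := inferInstance
  have : MeasurableSpace.CountablyGenerated (V × (ℕ → E ⊕ Unit)) := inferInstance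
  have : MeasurableSpace.CountablySeparated (V × (ℕ → E ⊕ Unit)) := inferInstance
  exact measurable_code.measurableEmbedding code_injective

end Measurability

end BoundaryPath

section Measurability

variable [MeasurableSpace V] [MeasurableSpace E]

theorem measurable_codeShift [BorelSpace V] [BorelSpace E] : Measurable G.codeShift := by
  refine Measurable.prodMk ?_ (measurable_pi_iff.2 fun n =>
    (measurable_pi_apply (n + 1)).comp measurable_snd)
  exact (measurable_sumElim_prod (f := fun z : V × E => G.s z.2) (g := fun z => z.1)
    (G.isLocalHomeomorph_s.continuous.measurable.comp measurable_snd) measurable_fst).comp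
      (measurable_fst.prodMk ((measurable_pi_apply 0).comp measurable_snd))

theorem measurable_consCode [BorelSpace V] [BorelSpace E] :
    Measurable fun z : E × (ℕ → E ⊕ Unit) => G.consCode z.1 z.2 := by
  refine (G.continuous_r.measurable.comp measurable_fst).prodMk (measurable_pi_iff.2 fun n => ?_)
  rcases n with _ | n
  · exact measurable_inl.comp measurable_fst
  · exact (measurable_pi_apply n).comp measurable_snd

end Measurability

end TopologicalGraph

/-! ### Pieces of the edge space on which the source is injective -/

namespace TopologicalGraph

variable {V E : Type*}
  [TopologicalSpace V] [T2Space V] [LocallyCompactSpace V] [SecondCountableTopology V]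
  [MeasurableSpace V] [BorelSpace V]
  [TopologicalSpace E] [T2Space E] [LocallyCompactSpace E] [SecondCountableTopology E]
  [MeasurableSpace E] [BorelSpace E]
  {G : TopologicalGraph V E}

variable (G) in
-- By second countability, countably many charts of the local homeomorphism `s` cover the edges;
-- making them disjoint keeps injectivity.
theorem exists_partition_injOn : ∃ D : ℕ → Set E, (∀ n, MeasurableSet (D n)) ∧
    Pairwise (Function.onFun Disjoint D) ∧ ⋃ n, D n = univ ∧ ∀ n, InjOn G.s (D n) := by
  rcases isEmpty_or_nonempty E with hE | hE
  · exact ⟨fun _ => ∅, fun _ => MeasurableSet.empty, fun _ _ _ => disjoint_bot_left,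
      by simp [eq_empty_of_isEmpty], fun _ => injOn_empty _⟩
  choose φ hφ hφs using G.isLocalHomeomorph_s
  obtain ⟨t, ht, htU⟩ := countable_cover_nhds
    (f := fun e => (φ e).source) (fun e => (φ e).open_source.mem_nhds (hφ e))
  have htne : t.Nonempty := by
    rw [nonempty_iff_ne_empty]
    rintro rfl
    exact empty_ne_univ (α := E) (by simpa using htU)
  obtain ⟨g, hg⟩ := ht.exists_eq_range htne
  refine ⟨disjointed fun n => (φ (g n)).source,
    MeasurableSet.disjointed fun n => (φ (g n)).open_source.measurableSet,
    disjoint_disjointed _, ?_, fun n => ?_⟩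
  · rw [iUnion_disjointed, ← htU, hg, biUnion_range]
  · refine InjOn.mono (disjointed_subset _ n) ?_
    rw [hφs (g n)]
    exact (φ (g n)).injOn

theorem measurableSet_image_source {B : Set E} (hB : MeasurableSet B) (hinj : InjOn G.s B) :
    MeasurableSet (G.s '' B) := by
  have := PolishSpace.of_locallyCompact (X := E)
  have := PolishSpace.of_locallyCompact (X := V)
  exact hB.image_of_measurable_injOn G.isLocalHomeomorph_s.continuous.measurable hinj

theorem pullback_apply_of_injOn (μ : Measure V) {B : Set E} (hB : MeasurableSet B)
    (hinj : InjOn G.s B) : G.pullback μ B = μ (G.s '' B) := by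
  rw [← lintegral_indicator_one hB, lintegral_pullback _ _ (measurable_one.indicator hB),
    ← lintegral_indicator_one (measurableSet_image_source hB hinj)]
  refine lintegral_congr fun v => ?_
  by_cases hv : v ∈ G.s '' B
  · obtain ⟨e, he, rfl⟩ := hv
    rw [indicator_of_mem (mem_image_of_mem G.s he), tsum_eq_single (⟨e, rfl⟩ : G.s ⁻¹' {G.s e}),
      indicator_of_mem he, Pi.one_apply, Pi.one_apply]
    rintro ⟨e', he'⟩ hne
    exact indicator_of_notMem (fun h => hne (Subtype.ext (hinj h he he'))) _
  · rw [indicator_of_notMem hv, ENNReal.tsum_eq_zero]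
    rintro ⟨e, he⟩
    exact indicator_of_notMem (fun h => hv ⟨e, h, he⟩) _

/-! ### Push-forward and uniqueness of invariant measures -/

namespace BoundaryPath

theorem measurable_shift : Measurable (shift : G.BoundaryPath → G.BoundaryPath) := by
  rw [← measurableEmbedding_code.measurable_comp_iff]
  have h : (code : G.BoundaryPath → _) ∘ shift = G.codeShift ∘ code := funext code_shift
  rw [h]
  exact measurable_codeShift.comp measurable_code

theorem eq_of_shift_eq {α β : G.BoundaryPath} {e : E} (hα : α.edge 0 = Sum.inl e)
    (hβ : β.edge 0 = Sum.inl e) (h : α.shift = β.shift) : α = β :=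
  code_injective (by rw [eq_consCode hα, eq_consCode hβ, h])

/-- With `s` injective on `B`, the range of the shifted path identifies the removed edge. So the
shift is injective on the left-hand set, and by `exists_prepend` its image is the right-hand one. -/
theorem IsInvariant.measure_inter_shift_preimage {ν : Measure G.BoundaryPath} (hν : IsInvariant ν)
    {B : Set E} (hB : MeasurableSet B) (hinj : InjOn G.s B) {C : Set G.BoundaryPath}
    (hC : MeasurableSet C) :
    ν ((fun α => α.edge 0) ⁻¹' (Sum.inl '' B) ∩ shift ⁻¹' C) = ν (range ⁻¹' (G.s '' B) ∩ C) := by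
  rw [← hν.shift_image]
  · congr 1
    ext β
    constructor
    · rintro ⟨α, ⟨⟨e, he, h⟩, hα⟩, rfl⟩
      exact ⟨⟨e, he, (range_shift h.symm).symm⟩, hα⟩
    · rintro ⟨⟨e, he, h⟩, hβ⟩
      obtain ⟨α, hα, rfl⟩ := exists_prepend h
      exact ⟨α, ⟨⟨e, he, hα.symm⟩, hβ⟩, rfl⟩
  · exact (measurable_edge 0 (measurableSet_inl_image.2 hB)).inter (measurable_shift hC)
  · rintro α ⟨⟨e, -, h⟩, -⟩ hα
    exact Sum.inl_ne_inr (h.trans (isVertex_iff.1 hα))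
  · rintro α ⟨⟨e, he, h⟩, -⟩ β ⟨⟨e', he', h'⟩, -⟩ hαβ
    have hs : G.s e = G.s e' := by
      rw [← range_shift h.symm, ← range_shift h'.symm, hαβ]
    obtain rfl := hinj he he' hs
    exact eq_of_shift_eq h.symm h'.symm hαβ

/-- On each piece of the partition both sides equal the `ν`-measure of the paths with range in the
`s`-image of that piece. -/
theorem IsInvariant.measure_edge_preimage {ν : Measure G.BoundaryPath} (hν : IsInvariant ν)
    {B : Set E} (hB : MeasurableSet B) :
    ν ((fun α => α.edge 0) ⁻¹' (Sum.inl '' B)) = G.pullback (ν.map range) B := by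
  obtain ⟨D, hD, hdisj, hcov, hinj⟩ := G.exists_partition_injOn
  have h1 := measure_eq_tsum_of_partition ν hD hdisj hcov (measurable_edge 0) hB MeasurableSet.univ
  have h2 := measure_eq_tsum_of_partition (G.pullback (ν.map range)) hD hdisj hcov
    measurable_inl hB MeasurableSet.univ
  simp only [inter_univ, preimage_image_eq _ Sum.inl_injective] at h1 h2
  rw [h1, h2]
  refine tsum_congr fun n => ?_
  have hi : InjOn G.s (B ∩ D n) := (hinj n).mono inter_subset_right
  have hm := hB.inter (hD n)
  rw [pullback_apply_of_injOn _ hm hi,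
    Measure.map_apply continuous_range.measurable (measurableSet_image_source hm hi)]
  simpa using hν.measure_inter_shift_preimage hm hi MeasurableSet.univ

theorem map_range_restrict {ν : Measure G.BoundaryPath} (hν : IsInvariant ν) :
    (ν.restrict ((fun α => α.edge 0) ⁻¹' (Sum.inl '' univ))).map range =
      (G.pullback (ν.map range)).map G.r := by
  ext A hA
  rw [Measure.map_apply continuous_range.measurable hA,
    Measure.restrict_apply (continuous_range.measurable hA),
    Measure.map_apply G.continuous_r.measurable hA,
    ← hν.measure_edge_preimage (G.continuous_r.measurable hA)]
  congr 1
  ext α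
  constructor
  · rintro ⟨h1, e, -, h⟩
    refine ⟨e, ?_, h⟩
    rw [mem_preimage, (isPathCode_code α).range_eq e h.symm]
    exact h1
  · rintro ⟨e, h1, h⟩
    refine ⟨?_, e, trivial, h⟩
    rw [mem_preimage, (isPathCode_code α).range_eq e h.symm] at h1
    exact h1

theorem IsInvariant.isVertexInvariant_map {ν : Measure G.BoundaryPath} (hν : IsInvariant ν) :
    G.IsVertexInvariant (ν.map range) := by
  have hreg := hν.regular
  have hfin : IsFiniteMeasureOnCompacts (ν.map range) := ⟨fun K hK => by
    rw [Measure.map_apply continuous_range.measurable hK.measurableSet]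
    exact (isCompact_range_preimage hK).measure_lt_top⟩
  have hmeas : ∀ f : V → ℝ, Continuous f → Measurable fun v => ENNReal.ofReal (f v) :=
    fun f hf => ENNReal.measurable_ofReal.comp hf.measurable
  have hleft : ∀ f : V → ℝ, Continuous f →
      ∫⁻ e, ENNReal.ofReal (f (G.r e)) ∂(G.pullback (ν.map range)) =
        ∫⁻ α in (fun α => α.edge 0) ⁻¹' (Sum.inl '' univ), ENNReal.ofReal (f α.range) ∂ν := by
    intro f hf
    rw [← lintegral_map (hmeas f hf) G.continuous_r.measurable, ← map_range_restrict hν,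
      lintegral_map (hmeas f hf) continuous_range.measurable]
  have hright : ∀ f : V → ℝ, Continuous f → ∫⁻ v, ENNReal.ofReal (f v) ∂(ν.map range) =
      ∫⁻ α, ENNReal.ofReal (f α.range) ∂ν := fun f hf =>
    lintegral_map (hmeas f hf) continuous_range.measurable
  refine ⟨inferInstance, fun f hf _ _ => ?_, fun f hf _ _ hsupp => ?_⟩
  · rw [hleft f hf, hright f hf]
    exact setLIntegral_le_lintegral _ _
  · rw [hleft f hf, hright f hf,
      ← lintegral_indicator (measurable_edge 0 (measurableSet_inl_image.2 MeasurableSet.univ))]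
    refine lintegral_congr fun α => ?_
    -- A path with no first edge is a singular vertex, where `f` vanishes by `hsupp`; hence dropping
    -- such paths does not change the integral.
    by_cases hα : α.edge 0 = Sum.inr ()
    · have h0 : f α.range = 0 := by
        by_contra hne
        exact (isPathCode_code α).singular_zero hα (hsupp (subset_tsupport f hne))
      rw [h0, ENNReal.ofReal_zero]
      exact indicator_apply_eq_zero.2 fun _ => by rw [h0, ENNReal.ofReal_zero]
    · refine indicator_of_mem ?_ _
      rcases h : α.edge 0 with e | u
      · exact ⟨e, trivial, h.symm⟩
      · exact absurd h hα

/-- The boundary paths of length at least `n` with prescribed sets of ranges and of first `n`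
edges. -/
def cylinder (n : ℕ) (A : Set V) (B : ℕ → Set E) : Set G.BoundaryPath :=
  {α | α.range ∈ A ∧ ∀ i < n, α.edge i ∈ Sum.inl '' B i}

theorem cylinder_zero (A : Set V) (B : ℕ → Set E) :
    (cylinder 0 A B : Set G.BoundaryPath) = range ⁻¹' A := by
  ext α
  simp [cylinder]

theorem measurableSet_cylinder {n : ℕ} {A : Set V} {B : ℕ → Set E} (hA : MeasurableSet A)
    (hB : ∀ i, MeasurableSet (B i)) : MeasurableSet (cylinder n A B : Set G.BoundaryPath) := by
  have h : (cylinder n A B : Set G.BoundaryPath) =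
      range ⁻¹' A ∩ ⋂ (i : ℕ) (_ : i < n), (fun α => α.edge i) ⁻¹' (Sum.inl '' B i) := by
    ext α
    simp [cylinder]
  rw [h]
  exact (continuous_range.measurable hA).inter (MeasurableSet.iInter fun i =>
    MeasurableSet.iInter fun _ => measurable_edge i (measurableSet_inl_image.2 (hB i)))

variable (G) in
/-- The cylinders over measurable sets. -/
def cylinders : Set (Set G.BoundaryPath) :=
  {C | ∃ (n : ℕ) (A : Set V) (B : ℕ → Set E), MeasurableSet A ∧ (∀ i, MeasurableSet (B i)) ∧
    C = cylinder n A B}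

theorem isPiSystem_cylinders : IsPiSystem (cylinders G) := by
  rintro _ ⟨n, A, B, hA, hB, rfl⟩ _ ⟨m, A', B', hA', hB', rfl⟩ -
  classical
  -- Both lists of edge sets are padded by `univ` to the larger length; beyond its own length a
  -- cylinder then only asks for an edge to exist, which the longer one already demands.
  refine ⟨max n m, A ∩ A', fun i => (if i < n then B i else univ) ∩ if i < m then B' i else univ,
    hA.inter hA', fun i => ?_, ?_⟩
  · refine MeasurableSet.inter ?_ ?_ <;> split_ifs
    exacts [hB i, MeasurableSet.univ, hB' i, MeasurableSet.univ]
  · ext α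
    simp only [cylinder, mem_inter_iff, mem_ofPred_eq, lt_max_iff]
    constructor
    · rintro ⟨⟨h1, h2⟩, h3, h4⟩
      refine ⟨⟨h1, h3⟩, fun i hi => ?_⟩
      by_cases hn : i < n
      · obtain ⟨e, he, h5⟩ := h2 i hn
        refine ⟨e, ⟨by rwa [if_pos hn], ?_⟩, h5⟩
        split_ifs with hm
        · obtain ⟨e', he', h6⟩ := h4 i hm
          obtain rfl := Sum.inl.inj (h5.trans h6.symm)
          exact he'
        · trivial
      · have hm := hi.resolve_left hn
        obtain ⟨e', he', h6⟩ := h4 i hm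
        exact ⟨e', ⟨by rw [if_neg hn]; trivial, by rwa [if_pos hm]⟩, h6⟩
    · rintro ⟨⟨h1, h3⟩, h⟩
      refine ⟨⟨h1, fun i hi => ?_⟩, h3, fun i hi => ?_⟩
      · obtain ⟨e, he, h5⟩ := h i (Or.inl hi)
        refine ⟨e, ?_, h5⟩
        simpa [hi] using he.1
      · obtain ⟨e, he, h5⟩ := h i (Or.inr hi)
        refine ⟨e, ?_, h5⟩
        simpa [hi] using he.2

theorem generateFrom_cylinders :
    (inferInstance : MeasurableSpace G.BoundaryPath) =
      MeasurableSpace.generateFrom (cylinders G) := by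
  refine le_antisymm ?_ (MeasurableSpace.generateFrom_le ?_)
  · have h : ∀ n A B, MeasurableSet A → (∀ i, MeasurableSet (B i)) →
        MeasurableSet[MeasurableSpace.generateFrom (cylinders G)] (cylinder n A B) :=
      fun n A B hA hB => MeasurableSpace.measurableSet_generateFrom ⟨n, A, B, hA, hB, rfl⟩
    rw [← measurableEmbedding_code.comap_eq, ← measurable_iff_comap_le]
    suffices h' : Measurable[MeasurableSpace.generateFrom (cylinders G)]
        (range : G.BoundaryPath → V) ∧ Measurable[MeasurableSpace.generateFrom (cylinders G)]
        (edge : G.BoundaryPath → ℕ → E ⊕ Unit) from h'.1.prodMk h'.2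
    refine ⟨?_, ?_⟩
    · intro A hA
      rw [← cylinder_zero A fun _ => univ]
      exact h 0 A (fun _ => univ) hA fun _ => MeasurableSet.univ
    · refine @measurable_pi_iff _ _ _ (MeasurableSpace.generateFrom (cylinders G)) _ _ |>.2
        fun n => ?_
      refine @measurable_sum_unit _ _ _ (MeasurableSpace.generateFrom (cylinders G)) _ fun B hB => ?_
      classical
      -- A stopped path stays stopped, so having an `n`-th edge forces all earlier ones to exist,
      -- and `univ` there imposes nothing more.
      convert h (n + 1) univ (fun i => if i = n then B else univ) (@MeasurableSet.univ V _)
        fun i => ?_ using 1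
      · ext α
        simp only [cylinder, mem_preimage, mem_ofPred_eq, mem_univ, true_and]
        constructor
        · intro hα i hi
          by_cases hin : i = n
          · subst hin
            simpa using hα
          · have hne : ∀ k, α.edge k = Sum.inr () → ∀ j, α.edge (k + j) = Sum.inr () := by
              intro k hk j
              induction j with
              | zero => exact hk
              | succ j ih => exact (isPathCode_code α).ends _ ih
            rcases hi' : α.edge i with e | u
            · exact ⟨e, by simp [hin], rfl⟩
            · have := hne i hi' (n - i)
              rw [Nat.add_sub_cancel' (by omega)] at this
              rw [this] at hα
              simp at hα
        · intro hα
          simpa using hα n (Nat.lt_succ_self n)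
      · split_ifs
        exacts [hB, MeasurableSet.univ]
  · rintro _ ⟨n, A, B, hA, hB, rfl⟩
    exact measurableSet_cylinder hA hB

/-- The cylinder is split according to the piece containing the first edge; on each piece the shift
is injective and removes that edge, turning its constraints into one on the range of the remaining
path. -/
theorem IsInvariant.measure_cylinder_succ {ν : Measure G.BoundaryPath} (hν : IsInvariant ν)
    {D : ℕ → Set E} (hD : ∀ n, MeasurableSet (D n)) (hdisj : Pairwise (Function.onFun Disjoint D))
    (hcov : ⋃ n, D n = univ) (hinj : ∀ n, InjOn G.s (D n)) (n : ℕ) {A : Set V} {B : ℕ → Set E}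
    (hA : MeasurableSet A) (hB : ∀ i, MeasurableSet (B i)) :
    ν (cylinder (n + 1) A B) =
      ∑' k, ν (cylinder n (G.s '' (B 0 ∩ G.r ⁻¹' A ∩ D k)) fun i => B (i + 1)) := by
  have hB' : ∀ i, MeasurableSet (B (i + 1)) := fun i => hB (i + 1)
  have hc : MeasurableSet (cylinder n univ (fun i => B (i + 1)) : Set G.BoundaryPath) :=
    measurableSet_cylinder MeasurableSet.univ hB'
  have h0 : MeasurableSet (B 0 ∩ G.r ⁻¹' A) := (hB 0).inter (G.continuous_r.measurable hA)
  have h : (cylinder (n + 1) A B : Set G.BoundaryPath) =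
      (fun α => α.edge 0) ⁻¹' (Sum.inl '' (B 0 ∩ G.r ⁻¹' A)) ∩
        shift ⁻¹' cylinder n univ fun i => B (i + 1) := by
    ext α
    have hs : ∀ i, α.shift.edge i = α.edge (i + 1) := congrFun (congrArg Prod.snd (code_shift α))
    simp only [cylinder, mem_ofPred_eq, mem_inter_iff, mem_preimage, mem_univ, true_and, hs]
    constructor
    · rintro ⟨h1, h2⟩
      obtain ⟨e, he, h3⟩ := h2 0 (Nat.succ_pos n)
      refine ⟨⟨e, ⟨he, ?_⟩, h3⟩, fun i hi => h2 _ (Nat.succ_lt_succ hi)⟩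
      rw [mem_preimage, (isPathCode_code α).range_eq e h3.symm]
      exact h1
    · rintro ⟨⟨e, ⟨he, h1⟩, h3⟩, h2⟩
      refine ⟨?_, ?_⟩
      · rw [mem_preimage, (isPathCode_code α).range_eq e h3.symm] at h1
        exact h1
      · rintro (_ | i) hi
        · exact ⟨e, he, h3⟩
        · exact h2 i (Nat.lt_of_succ_lt_succ hi)
  rw [h, measure_eq_tsum_of_partition ν hD hdisj hcov (measurable_edge 0) h0 (measurable_shift hc)]
  refine tsum_congr fun k => ?_
  rw [hν.measure_inter_shift_preimage (h0.inter (hD k)) ((hinj k).mono inter_subset_right) hc]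
  congr 1
  ext α
  simp [cylinder]

theorem IsInvariant.eq_of_map_range_eq {ν₁ ν₂ : Measure G.BoundaryPath} (h₁ : IsInvariant ν₁)
    (h₂ : IsInvariant ν₂) (h : ν₁.map range = ν₂.map range) : ν₁ = ν₂ := by
  obtain ⟨D, hD, hdisj, hcov, hinj⟩ := G.exists_partition_injOn
  have hcyl : ∀ n A (B : ℕ → Set E), MeasurableSet A → (∀ i, MeasurableSet (B i)) →
      ν₁ (cylinder n A B) = ν₂ (cylinder n A B) := by
    intro n
    induction n with
    | zero =>
      intro A B hA _
      rw [cylinder_zero, ← Measure.map_apply continuous_range.measurable hA, h,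
        Measure.map_apply continuous_range.measurable hA]
    | succ n ih =>
      intro A B hA hB
      rw [h₁.measure_cylinder_succ hD hdisj hcov hinj n hA hB,
        h₂.measure_cylinder_succ hD hdisj hcov hinj n hA hB]
      refine tsum_congr fun k => ih _ _ ?_ fun i => hB (i + 1)
      exact measurableSet_image_source
        (((hB 0).inter (G.continuous_r.measurable hA)).inter (hD k))
        ((hinj k).mono inter_subset_right)
  have hreg := h₁.regular
  -- The length-zero cylinders over a compact covering of `V` exhaust the space, and have finite
  -- measure because `range` is proper.
  refine Measure.ext_of_generateFrom_of_iUnion (cylinders G)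
    (fun k => cylinder 0 (compactCovering V k) fun _ => univ) generateFrom_cylinders
    isPiSystem_cylinders ?_ (fun k => ?_) (fun k => ?_) ?_
  · refine eq_univ_of_forall fun α => ?_
    have : α.range ∈ ⋃ k, compactCovering V k := by
      rw [iUnion_compactCovering]
      trivial
    obtain ⟨k, hk⟩ := mem_iUnion.1 this
    exact mem_iUnion.2 ⟨k, hk, by simp⟩
  · exact ⟨0, _, _, (isCompact_compactCovering V k).measurableSet, fun _ => MeasurableSet.univ, rfl⟩
  · rw [cylinder_zero]
    exact (isCompact_range_preimage (isCompact_compactCovering V k)).measure_lt_top.ne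
  · rintro _ ⟨n, A, B, hA, hB, rfl⟩
    exact hcyl n A B hA hB

end BoundaryPath

end TopologicalGraph

/-! ### Subtraction, randomization and independent sequences -/

section GeneralMeasureTheory

open ProbabilityTheory unitInterval

/-- The difference has density `1 - dm/dμ`, where `dm/dμ ≤ 1` almost everywhere. -/
theorem MeasureTheory.Measure.exists_add_eq_of_le {X : Type*} [MeasurableSpace X]
    {m μ : Measure X} [SigmaFinite μ] (h : m ≤ μ) : ∃ m' : Measure X, m + m' = μ := by
  have : SigmaFinite m := Measure.sigmaFinite_of_le μ h
  refine ⟨μ.withDensity (1 - m.rnDeriv μ), ?_⟩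
  nth_rw 1 [← Measure.withDensity_rnDeriv_eq m μ (Measure.absolutelyContinuous_of_le h)]
  rw [← withDensity_add_left (Measure.measurable_rnDeriv m μ)]
  conv_rhs => rw [← withDensity_one (μ := μ)]
  refine withDensity_congr_ae ?_
  filter_upwards [Measure.rnDeriv_le_one_of_le h] with x hx
  exact add_tsub_cancel_of_le hx

/-- A measure on a product with `σ`-finite first marginal is obtained from that marginal by
randomizing the second coordinate. -/
theorem exists_measurable_map_prod_unitInterval {X Y : Type*} [MeasurableSpace X]
    [MeasurableSpace Y] [StandardBorelSpace Y] [Nonempty Y] (ρ : Measure (X × Y))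
    [SigmaFinite ρ.fst] : ∃ g : X → I → Y, Measurable (Function.uncurry g) ∧
      (ρ.fst.prod volume).map (fun z => (z.1, g z.1 z.2)) = ρ := by
  -- A strictly positive weight on the first coordinate makes the measure finite, so that it has a
  -- conditional kernel. The kernel is realized by `g`, and since the weight ignores the second
  -- coordinate it can be divided out at the end.
  obtain ⟨w, hw0, hw, hwfin⟩ := exists_pos_lintegral_lt_of_sigmaFinite ρ.fst one_ne_zero
  have hw' : Measurable fun x => (w x : ℝ≥0∞) := hw.coe_nnreal_ennreal
  have hwf : Measurable fun z : X × Y => (w z.1 : ℝ≥0∞) := hw'.comp measurable_fst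
  let ρ' := ρ.withDensity fun z => (w z.1 : ℝ≥0∞)
  have hfst : ρ'.fst = ρ.fst.withDensity fun x => (w x : ℝ≥0∞) := by
    ext A hA
    rw [Measure.fst_apply hA, withDensity_apply _ (measurable_fst hA), withDensity_apply _ hA,
      Measure.fst, setLIntegral_map hA hw' measurable_fst]
  have hfin : IsFiniteMeasure ρ' := ⟨by
    rw [withDensity_apply _ MeasurableSet.univ, Measure.restrict_univ]
    rw [Measure.fst, lintegral_map hw' measurable_fst] at hwfin
    exact hwfin.trans ENNReal.one_lt_top⟩
  obtain ⟨g, hg, hgκ⟩ := Kernel.exists_measurable_map_eq_unitInterval ρ'.condKernel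
  refine ⟨g, hg, ?_⟩
  have hG : Measurable fun z : X × I => (z.1, g z.1 z.2) := measurable_fst.prodMk hg
  have key : ((ρ.fst.prod volume).map fun z : X × I => (z.1, g z.1 z.2)).withDensity
      (fun z => (w z.1 : ℝ≥0∞)) = ρ' := by
    refine Measure.ext_of_lintegral _ fun F hF => ?_
    rw [lintegral_withDensity_eq_lintegral_mul _ hwf hF, lintegral_map (hwf.mul hF) hG,
      lintegral_prod (fun z : X × I => ((fun z : X × Y => (w z.1 : ℝ≥0∞)) * F) (z.1, g z.1 z.2))
        ((hwf.mul hF).comp hG).aemeasurable]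
    conv_rhs => rw [← ρ'.disintegrate ρ'.condKernel, Measure.lintegral_compProd hF, hfst,
      lintegral_withDensity_eq_lintegral_mul _ hw' hF.lintegral_kernel_prod_right']
    refine lintegral_congr fun x => ?_
    have hx : Measurable (g x) := hg.comp measurable_prodMk_left
    have hFx : Measurable fun y => F (x, y) := hF.comp measurable_prodMk_left
    simp only [Pi.mul_apply]
    rw [← hgκ x, lintegral_map hFx hx]
    exact lintegral_const_mul _ (hFx.comp hx)
  have h1 : ∀ z : X × Y, (w z.1 : ℝ≥0∞) ≠ 0 := fun z => ENNReal.coe_ne_zero.2 (hw0 z.1).ne'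
  have h2 : ∀ z : X × Y, (w z.1 : ℝ≥0∞) ≠ ∞ := fun z => ENNReal.coe_ne_top
  have h3 := withDensity_inv_same (μ := (ρ.fst.prod volume).map fun z : X × I => (z.1, g z.1 z.2))
    hwf (Filter.Eventually.of_forall h1) (Filter.Eventually.of_forall h2)
  rw [key] at h3
  exact h3.symm.trans (withDensity_inv_same hwf (Filter.Eventually.of_forall h1)
    (Filter.Eventually.of_forall h2))

/-- Prepend a term to a sequence. -/
def consSeq {X : Type*} (z : X × (ℕ → X)) : ℕ → X := fun n => Nat.casesOn n z.1 z.2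

theorem measurable_consSeq {X : Type*} [MeasurableSpace X] :
    Measurable (consSeq : X × (ℕ → X) → ℕ → X) := by
  refine measurable_pi_iff.2 fun n => ?_
  rcases n with _ | n
  · exact measurable_fst
  · exact (measurable_pi_apply n).comp measurable_snd

/-- A product measure is determined by finite boxes, and a box pulls back to a condition on the head
times a box for the tail. This separates the first random choice from the later ones. -/
theorem map_consSeq_infinitePi {X : Type*} [MeasurableSpace X] (P : Measure X)
    [IsProbabilityMeasure P] :
    (P.prod (Measure.infinitePi fun _ : ℕ => P)).map consSeq =
      Measure.infinitePi fun _ : ℕ => P := by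
  classical
  refine Measure.eq_infinitePi _ fun s t ht => ?_
  have hs : MeasurableSet ((s : Set ℕ).pi t) :=
    MeasurableSet.pi s.countable_toSet fun i _ => ht i
  let s' : Finset ℕ := s.preimage Nat.succ (Nat.succ_injective.injOn)
  have h : consSeq ⁻¹' ((s : Set ℕ).pi t) =
      (if 0 ∈ s then t 0 else univ) ×ˢ (s' : Set ℕ).pi fun i => t (i + 1) := by
    ext ⟨x, y⟩
    simp only [mem_preimage, Set.mem_pi, mem_prod, s', Finset.mem_coe, Finset.mem_preimage]
    constructor
    · intro h
      refine ⟨?_, fun i hi => h (i + 1) hi⟩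
      split_ifs with h0
      · exact h 0 h0
      · trivial
    · rintro ⟨h0, h1⟩ (_ | i) hi
      · rw [if_pos hi] at h0
        exact h0
      · exact h1 i hi
  rw [Measure.map_apply measurable_consSeq hs, h, Measure.prod_prod,
    Measure.infinitePi_pi _ fun i _ => ht (i + 1)]
  have h2 : ∏ i ∈ s', P (t (i + 1)) = ∏ i ∈ s.erase 0, P (t i) := by
    refine Finset.prod_bij (fun i _ => i + 1) ?_ ?_ ?_ ?_
    · intro i hi
      simpa [s'] using hi
    · intro i _ j _ hij
      exact Nat.succ_injective hij
    · rintro (_ | j) hj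
      · simp at hj
      · exact ⟨j, by simpa [s'] using hj, rfl⟩
    · intro i _
      rfl
  rw [h2]
  split_ifs with h0
  · exact Finset.mul_prod_erase s (fun i => P (t i)) h0
  · rw [measure_univ, one_mul, Finset.erase_eq_of_notMem h0]

end GeneralMeasureTheory

/-! ### The defect of a vertex-invariant measure -/

namespace TopologicalGraph

variable {V E : Type*}
  [TopologicalSpace V] [T2Space V] [LocallyCompactSpace V] [SecondCountableTopology V]
  [MeasurableSpace V] [BorelSpace V]
  [TopologicalSpace E] [T2Space E] [LocallyCompactSpace E] [SecondCountableTopology E]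
  [MeasurableSpace E] [BorelSpace E]
  {G : TopologicalGraph V E}

namespace IsVertexInvariant

/-- The inequality for test functions passes to compact sets by Urysohn functions and outer
regularity of `μ`. It then makes `r_* s^*μ` finite on compact sets, hence regular, so inner
regularity on open sets extends it to all sets. -/
theorem map_pullback_le {μ : Measure V} (hμ : G.IsVertexInvariant μ) :
    (G.pullback μ).map G.r ≤ μ := by
  have hreg := hμ.regular
  have hK : ∀ K, IsCompact K → (G.pullback μ).map G.r K ≤ μ K := by
    intro K hK
    rw [K.measure_eq_iInf_isOpen μ]
    refine le_iInf₂ fun O hKO => le_iInf fun hO => ?_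
    obtain ⟨f, hf1, hf0, hfc, hf⟩ := exists_continuous_one_zero_of_isCompact hK hO.isClosed_compl
      (disjoint_compl_right_iff_subset.2 hKO)
    have hfm : Measurable fun v => ENNReal.ofReal (f v) :=
      ENNReal.measurable_ofReal.comp f.continuous.measurable
    calc (G.pullback μ).map G.r K
        = ∫⁻ v, K.indicator 1 v ∂((G.pullback μ).map G.r) :=
          (lintegral_indicator_one hK.measurableSet).symm
      _ ≤ ∫⁻ v, ENNReal.ofReal (f v) ∂((G.pullback μ).map G.r) := by
          refine lintegral_mono (indicator_le fun v hv => ?_)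
          simp [hf1 hv]
      _ = ∫⁻ e, ENNReal.ofReal (f (G.r e)) ∂(G.pullback μ) :=
          lintegral_map hfm G.continuous_r.measurable
      _ ≤ ∫⁻ v, ENNReal.ofReal (f v) ∂μ := hμ.le f f.continuous hfc fun v => (hf v).1
      _ ≤ ∫⁻ v, O.indicator 1 v ∂μ := by
          refine lintegral_mono fun v => ?_
          by_cases hv : v ∈ O
          · simpa [hv] using (hf v).2
          · simp [hf0 hv]
      _ = μ O := lintegral_indicator_one hO.measurableSet
  have hfin : IsFiniteMeasureOnCompacts ((G.pullback μ).map G.r) :=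
    ⟨fun K h => (hK K h).trans_lt h.measure_lt_top⟩
  refine Measure.le_iff.2 fun A _ => ?_
  rw [A.measure_eq_iInf_isOpen μ]
  refine le_iInf₂ fun O hAO => le_iInf fun hO => (measure_mono hAO).trans ?_
  rw [hO.measure_eq_iSup_isCompact]
  exact iSup₂_le fun K hKO => iSup_le fun h => (hK K h).trans (measure_mono hKO)

/-- Here the Urysohn function must also have support in the open set of regular vertices, which the
intermediate compact set `L` ensures; outer regularity is now that of `r_* s^*μ`. -/
theorem measure_le_map_pullback {μ : Measure V} (hμ : G.IsVertexInvariant μ) {K : Set V}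
    (hK : IsCompact K) (hKreg : K ⊆ G.regularVertices) : μ K ≤ (G.pullback μ).map G.r K := by
  have hreg := hμ.regular
  have hfin : IsFiniteMeasureOnCompacts ((G.pullback μ).map G.r) :=
    ⟨fun K h => (hμ.map_pullback_le K).trans_lt h.measure_lt_top⟩
  rw [K.measure_eq_iInf_isOpen ((G.pullback μ).map G.r)]
  refine le_iInf₂ fun O hKO => le_iInf fun hO => ?_
  obtain ⟨L, hL, hKL, hLO⟩ := exists_compact_between hK (hO.inter G.isOpen_regularVertices)
    (subset_inter hKO hKreg)
  obtain ⟨f, hf1, hf0, hfc, hf⟩ := exists_continuous_one_zero_of_isCompact hK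
    isOpen_interior.isClosed_compl (disjoint_compl_right_iff_subset.2 hKL)
  have hfm : Measurable fun v => ENNReal.ofReal (f v) :=
    ENNReal.measurable_ofReal.comp f.continuous.measurable
  have hfL : Function.support f ⊆ L := fun v hv =>
    interior_subset (by_contra fun h => hv (hf0 h))
  have hsupp : tsupport f ⊆ G.regularVertices :=
    (closure_minimal hfL hL.isClosed).trans (hLO.trans inter_subset_right)
  calc μ K = ∫⁻ v, K.indicator 1 v ∂μ := (lintegral_indicator_one hK.measurableSet).symm
    _ ≤ ∫⁻ v, ENNReal.ofReal (f v) ∂μ := by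
        refine lintegral_mono (indicator_le fun v hv => ?_)
        simp [hf1 hv]
    _ = ∫⁻ e, ENNReal.ofReal (f (G.r e)) ∂(G.pullback μ) :=
        (hμ.eq f f.continuous hfc (fun v => (hf v).1) hsupp).symm
    _ = ∫⁻ v, ENNReal.ofReal (f v) ∂((G.pullback μ).map G.r) :=
        (lintegral_map hfm G.continuous_r.measurable).symm
    _ ≤ ∫⁻ v, O.indicator 1 v ∂((G.pullback μ).map G.r) := by
        refine lintegral_mono fun v => ?_
        by_cases hv : v ∈ O
        · simpa [hv] using (hf v).2
        · have : v ∉ Function.support f := fun h => hv (hLO (hfL h)).1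
          simp [Function.notMem_support.1 this]
    _ = (G.pullback μ).map G.r O := lintegral_indicator_one hO.measurableSet

theorem exists_map_pullback_add_eq {μ : Measure V} (hμ : G.IsVertexInvariant μ) :
    ∃ m : Measure V, (G.pullback μ).map G.r + m = μ ∧ m G.regularVertices = 0 := by
  have hreg := hμ.regular
  obtain ⟨m, hm⟩ := Measure.exists_add_eq_of_le hμ.map_pullback_le
  refine ⟨m, hm, ?_⟩
  have hmμ : m ≤ μ := hm ▸ Measure.le_add_left le_rfl
  have hfin : IsFiniteMeasureOnCompacts m := ⟨fun K h => (hmμ K).trans_lt h.measure_lt_top⟩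
  rw [G.isOpen_regularVertices.measure_eq_iSup_isCompact]
  simp only [ENNReal.iSup_eq_zero]
  intro K hKreg hK
  have h1 : (G.pullback μ).map G.r K + m K = μ K := by
    conv_rhs => rw [← hm, Measure.add_apply]
  have h2 := hμ.measure_le_map_pullback hK hKreg
  have h3 : (G.pullback μ).map G.r K ≠ ∞ :=
    ((hμ.map_pullback_le K).trans_lt hK.measure_lt_top).ne
  rw [← h1] at h2
  exact le_antisymm ((ENNReal.add_le_add_iff_left h3).1 (by simpa using h2)) bot_le

end IsVertexInvariant

end TopologicalGraph

/-! ### Random paths -/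

namespace TopologicalGraph

open ProbabilityTheory unitInterval

variable {V E : Type*}
  [TopologicalSpace V] [T2Space V] [LocallyCompactSpace V] [SecondCountableTopology V]
  [MeasurableSpace V] [BorelSpace V]
  [TopologicalSpace E] [T2Space E] [LocallyCompactSpace E] [SecondCountableTopology E]
  [MeasurableSpace E] [BorelSpace E]
  {G : TopologicalGraph V E}

variable (G) in
/-- The sequence of edges obtained from a vertex and a sequence of random numbers, if at each
vertex `v` the next edge is chosen as `g v u` for the next random number `u`. -/
def randomEdges (g : V → I → E ⊕ Unit) (v : V) (u : ℕ → I) : ℕ → E ⊕ Unit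
  | 0 => g v (u 0)
  | n + 1 => Sum.elim (fun e => g (G.s e) (u (n + 1))) (fun _ => Sum.inr ())
      (randomEdges g v u n)

variable (G) in
/-- The first edge together with the subsequent random edges. -/
def continueRandomEdges (g : V → I → E ⊕ Unit) (x : E ⊕ Unit) (u : ℕ → I) : ℕ → E ⊕ Unit :=
  fun n => Nat.casesOn n x fun n =>
    Sum.elim (fun e => G.randomEdges g (G.s e) u n) (fun _ => Sum.inr ()) x

/-- The Markov property, sample by sample: after the first step, the remaining random numbers drive
a fresh path from the source of the first edge. -/
theorem randomEdges_consSeq (g : V → I → E ⊕ Unit) (v : V) (z : I × (ℕ → I)) :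
    G.randomEdges g v (consSeq z) = G.continueRandomEdges g (g v z.1) z.2 := by
  funext n
  induction n with
  | zero => rfl
  | succ n ih =>
    rw [randomEdges, ih]
    rcases n with _ | n
    · rfl
    · rcases h : g v z.1 with e | w <;> simp only [continueRandomEdges] <;> rfl

theorem continueRandomEdges_inl (g : V → I → E ⊕ Unit) (e : E) (u : ℕ → I) :
    (G.r e, G.continueRandomEdges g (Sum.inl e) u) =
      G.consCode e (G.randomEdges g (G.s e) u) := rfl

theorem continueRandomEdges_inr (g : V → I → E ⊕ Unit) (u : ℕ → I) :
    G.continueRandomEdges g (Sum.inr ()) u = fun _ => Sum.inr () := by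
  funext n
  rcases n with _ | n <;> rfl

theorem measurable_randomEdges {g : V → I → E ⊕ Unit} (hg : Measurable (Function.uncurry g)) :
    Measurable fun z : V × (ℕ → I) => G.randomEdges g z.1 z.2 := by
  refine measurable_pi_iff.2 fun n => ?_
  induction n with
  | zero =>
    exact hg.comp (measurable_fst.prodMk ((measurable_pi_apply 0).comp measurable_snd))
  | succ n ih =>
    have h : Measurable fun z : (ℕ → I) × E => g (G.s z.2) (z.1 (n + 1)) :=
      hg.comp ((G.isLocalHomeomorph_s.continuous.measurable.comp measurable_snd).prodMk
        ((measurable_pi_apply (n + 1)).comp measurable_fst))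
    exact (measurable_sumElim_prod (g := fun _ : (ℕ → I) × Unit => Sum.inr ()) h
      measurable_const).comp
      (measurable_snd.prodMk ih)

theorem measurable_continueRandomEdges {g : V → I → E ⊕ Unit}
    (hg : Measurable (Function.uncurry g)) :
    Measurable fun z : (E ⊕ Unit) × (ℕ → I) => G.continueRandomEdges g z.1 z.2 := by
  refine measurable_pi_iff.2 fun n => ?_
  rcases n with _ | n
  · exact measurable_fst
  · have h : Measurable fun z : (ℕ → I) × E => G.randomEdges g (G.s z.2) z.1 n :=
      (measurable_pi_apply n).comp ((measurable_randomEdges hg).comp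
        ((G.isLocalHomeomorph_s.continuous.measurable.comp measurable_snd).prodMk measurable_fst))
    exact (measurable_sumElim_prod (g := fun _ : (ℕ → I) × Unit => Sum.inr ()) h
      measurable_const).comp
      (measurable_snd.prodMk measurable_fst)

theorem countable_source_fiber (v : V) : (G.s ⁻¹' {v}).Countable := by
  obtain ⟨D, -, -, hcov, hinj⟩ := G.exists_partition_injOn
  have h : G.s ⁻¹' {v} = ⋃ n, G.s ⁻¹' {v} ∩ D n := by
    rw [← inter_iUnion, hcov, inter_univ]
  rw [h]
  refine countable_iUnion fun n => Subsingleton.countable ?_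
  exact fun e he e' he' => hinj n he.2 he'.2 (he.1.trans he'.1.symm)

/-- The law of the uniform random numbers. -/
noncomputable abbrev uniformLaw : Measure (ℕ → I) := Measure.infinitePi fun _ : ℕ => volume

variable (G) in
/-- The law of the encoded random path with initial distribution `μ`. -/
noncomputable def randomPathLaw (μ : Measure V) (g : V → I → E ⊕ Unit) :
    Measure (V × (ℕ → E ⊕ Unit)) :=
  (μ.prod uniformLaw).map fun z => (z.1, G.randomEdges g z.1 z.2)

theorem lintegral_randomPathLaw {μ : Measure V} [SFinite μ] {g : V → I → E ⊕ Unit}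
    (hg : Measurable (Function.uncurry g)) {F : V × (ℕ → E ⊕ Unit) → ℝ≥0∞} (hF : Measurable F) :
    ∫⁻ x, F x ∂(G.randomPathLaw μ g) =
      ∫⁻ v, ∫⁻ u, F (v, G.randomEdges g v u) ∂uniformLaw ∂μ := by
  have h : Measurable fun z : V × (ℕ → I) => (z.1, G.randomEdges g z.1 z.2) :=
    measurable_fst.prodMk (measurable_randomEdges hg)
  rw [randomPathLaw, lintegral_map hF h]
  exact lintegral_prod (fun z : V × (ℕ → I) => F (z.1, G.randomEdges g z.1 z.2))
    (hF.comp h).aemeasurable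

/-- Decomposition of the law of the random path according to its first edge. -/
theorem lintegral_randomPathLaw_eq_add {μ m : Measure V} [SFinite μ] {g : V → I → E ⊕ Unit}
    (hg : Measurable (Function.uncurry g))
    (hstep : (μ.prod volume).map (fun z : V × I => (z.1, g z.1 z.2)) =
      (G.pullback μ).map (fun e => (G.r e, Sum.inl e)) + m.map fun v => (v, Sum.inr ()))
    {F : V × (ℕ → E ⊕ Unit) → ℝ≥0∞} (hF : Measurable F) :
    ∫⁻ x, F x ∂(G.randomPathLaw μ g) =
      (∫⁻ v, ∫⁻ u, ∑' e : G.s ⁻¹' {v}, F (G.consCode e (G.randomEdges g v u)) ∂uniformLaw ∂μ) +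
        ∫⁻ v, F (v, fun _ => Sum.inr ()) ∂m := by
  have hcont := measurable_continueRandomEdges (G := G) hg
  -- `H (v, x)` averages `F` over the fresh continuations after first step `x` from `v`. Hence the
  -- integral of `F` is that of `H` against the one-step law, which `hstep` splits into moving and
  -- stopping.
  let H : V × (E ⊕ Unit) → ℝ≥0∞ := fun z =>
    ∫⁻ u, F (z.1, G.continueRandomEdges g z.2 u) ∂uniformLaw
  have hH : Measurable H := by
    refine Measurable.lintegral_prod_right' (f := fun z : (V × (E ⊕ Unit)) × (ℕ → I) =>
      F (z.1.1, G.continueRandomEdges g z.1.2 z.2)) ?_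
    exact hF.comp ((measurable_fst.comp measurable_fst).prodMk
      (hcont.comp ((measurable_snd.comp measurable_fst).prodMk measurable_snd)))
  have hG : Measurable fun z : V × I => (z.1, g z.1 z.2) := measurable_fst.prodMk hg
  have hr : Measurable fun e : E => (G.r e, (Sum.inl e : E ⊕ Unit)) :=
    G.continuous_r.measurable.prodMk measurable_inl
  have hi : Measurable fun v : V => (v, (Sum.inr () : E ⊕ Unit)) :=
    measurable_id.prodMk measurable_const
  have h1 : ∫⁻ x, F x ∂(G.randomPathLaw μ g) =
      ∫⁻ z, H z ∂((μ.prod volume).map fun z : V × I => (z.1, g z.1 z.2)) := by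
    rw [lintegral_randomPathLaw hg hF, lintegral_map hH hG,
      lintegral_prod (fun z : V × I => H (z.1, g z.1 z.2)) (hH.comp hG).aemeasurable]
    refine lintegral_congr fun v => ?_
    have hv : Measurable fun u => F (v, G.randomEdges g v u) :=
      hF.comp (measurable_const.prodMk ((measurable_randomEdges hg).comp measurable_prodMk_left))
    rw [uniformLaw, ← map_consSeq_infinitePi, lintegral_map hv measurable_consSeq,
      lintegral_prod (fun z : I × (ℕ → I) => F (v, G.randomEdges g v (consSeq z)))
        (hv.comp measurable_consSeq).aemeasurable]
    refine lintegral_congr fun t => ?_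
    simp only [randomEdges_consSeq, H]
  rw [h1, hstep, lintegral_add_measure, lintegral_map hH hr, lintegral_map hH hi,
    lintegral_pullback G μ (h := fun e => H (G.r e, Sum.inl e)) (hH.comp hr)]
  congr 1
  · refine lintegral_congr fun v => ?_
    have : Countable (G.s ⁻¹' {v}) := (countable_source_fiber v).to_subtype
    rw [lintegral_tsum fun e => ?_]
    · refine tsum_congr fun e => ?_
      have he : G.s e = v := e.2
      simp only [H, continueRandomEdges_inl, he]
    · refine (hF.comp ?_).aemeasurable
      exact measurable_consCode.comp (measurable_const.prodMk
        ((measurable_randomEdges hg).comp measurable_prodMk_left))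
  · refine lintegral_congr fun v => ?_
    simp [H, continueRandomEdges_inr]

variable (G) in
/-- The first step of an encoded path is that of a boundary path. -/
def StartsWell (x : V × (ℕ → E ⊕ Unit)) : Prop :=
  (∃ e, x.2 0 = Sum.inl e ∧ G.r e = x.1) ∨
    (x.2 0 = Sum.inr () ∧ x.2 1 = Sum.inr () ∧ x.1 ∈ G.singularVertices)

theorem measurableSet_startsWell : MeasurableSet {x | G.StartsWell x} := by
  have h0 : ∀ n, Measurable fun x : V × (ℕ → E ⊕ Unit) => x.2 n := fun n =>
    (measurable_pi_apply n).comp measurable_snd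
  have h1 : Measurable fun x : V × (ℕ → E ⊕ Unit) => Sum.elim G.r (fun _ => x.1) (x.2 0) :=
    (measurable_sumElim_prod (f := fun z : V × E => G.r z.2) (g := fun z => z.1)
      (G.continuous_r.measurable.comp measurable_snd) measurable_fst).comp
        (measurable_fst.prodMk (h0 0))
  have hinr : ∀ n, MeasurableSet {x : V × (ℕ → E ⊕ Unit) | x.2 n = Sum.inr ()} := by
    intro n
    have := h0 n (measurableSet_inr_image.2 (MeasurableSet.univ (α := Unit)))
    convert this using 1
    ext x
    simp only [mem_ofPred_eq, mem_preimage, image_univ, mem_range]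
    exact ⟨fun h => ⟨(), h.symm⟩, fun ⟨_, h⟩ => h.symm⟩
  have h : {x | G.StartsWell x} =
      ({x : V × (ℕ → E ⊕ Unit) | x.2 0 = Sum.inr ()}ᶜ ∩ {x | Sum.elim G.r (fun _ => x.1) (x.2 0) = x.1}) ∪
      ({x : V × (ℕ → E ⊕ Unit) | x.2 0 = Sum.inr ()} ∩ ({x : V × (ℕ → E ⊕ Unit) | x.2 1 = Sum.inr ()} ∩
        Prod.fst ⁻¹' G.singularVertices)) := by
    ext x
    simp only [StartsWell, mem_ofPred_eq, mem_union, mem_inter_iff, mem_compl_iff, mem_preimage]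
    refine or_congr ?_ Iff.rfl
    rcases x.2 0 with e | u <;> simp
  rw [h]
  exact ((hinr 0).compl.inter (measurableSet_eq_fun h1 measurable_fst)).union
    ((hinr 0).inter ((hinr 1).inter
      (measurable_fst G.isOpen_regularVertices.measurableSet.compl)))

theorem codeShift_iterate_snd (n : ℕ) (x : V × (ℕ → E ⊕ Unit)) (k : ℕ) :
    (G.codeShift^[n] x).2 k = x.2 (n + k) := by
  induction n generalizing k with
  | zero => simp
  | succ n ih =>
    rw [Function.iterate_succ_apply']
    exact (ih (k + 1)).trans (congrArg x.2 (by omega))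

/-- All conditions on a code are local, involving two consecutive positions; after `n + 1` shifts
the first component is the source of edge `n`, if there is one. -/
theorem isPathCode_of_startsWell {x : V × (ℕ → E ⊕ Unit)}
    (h : ∀ n, G.StartsWell (G.codeShift^[n] x)) : G.IsPathCode x := by
  have hinl : ∀ n e, x.2 n = Sum.inl e → G.r e = (G.codeShift^[n] x).1 := by
    intro n e he
    rcases h n with ⟨e', he', h'⟩ | ⟨h', -⟩
    · rw [codeShift_iterate_snd, Nat.add_zero, he] at he'
      rw [Sum.inl.inj he', h']
    · rw [codeShift_iterate_snd, Nat.add_zero, he] at h'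
      exact (Sum.inl_ne_inr h').elim
  have hinr : ∀ n, x.2 n = Sum.inr () →
      x.2 (n + 1) = Sum.inr () ∧ (G.codeShift^[n] x).1 ∈ G.singularVertices := by
    intro n hn
    rcases h n with ⟨e', he', -⟩ | ⟨-, h1, h2⟩
    · rw [codeShift_iterate_snd, Nat.add_zero, hn] at he'
      exact (Sum.inr_ne_inl he').elim
    · rw [codeShift_iterate_snd] at h1
      exact ⟨h1, h2⟩
  have hsucc : ∀ n e, x.2 n = Sum.inl e → (G.codeShift^[n + 1] x).1 = G.s e := by
    intro n e he
    rw [Function.iterate_succ_apply']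
    simp [codeShift, codeShift_iterate_snd, he]
  refine ⟨fun e he => hinl 0 e he, fun n e e' he he' => ?_, fun n hn => (hinr n hn).1,
    fun h0 => (hinr 0 h0).2, fun n e he hn => ?_⟩
  · rw [hinl _ _ he', hsucc n e he]
  · rw [← hsucc n e he]
    exact (hinr _ hn).2

/-- Induction on the number of shifts, via the first-step decomposition. Paths that stop at once are
fixed by the shift and are `m`-almost surely at singular vertices. For the others, the first step is
good by construction, and a failure after `n + 1` shifts is a failure after `n` shifts of the fresh
path from `s(e)`, which is null under the same law. -/
theorem ae_isPathCode_randomPathLaw {μ m : Measure V} [SFinite μ] {g : V → I → E ⊕ Unit}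
    (hg : Measurable (Function.uncurry g))
    (hstep : (μ.prod volume).map (fun z : V × I => (z.1, g z.1 z.2)) =
      (G.pullback μ).map (fun e => (G.r e, Sum.inl e)) + m.map fun v => (v, Sum.inr ()))
    (hm : m G.regularVertices = 0) : ∀ᵐ x ∂(G.randomPathLaw μ g), G.IsPathCode x := by
  have hmeas : ∀ n, MeasurableSet (G.codeShift^[n] ⁻¹' {x | G.StartsWell x}ᶜ) := fun n =>
    (measurable_codeShift.iterate n) measurableSet_startsWell.compl
  suffices h : ∀ n, G.randomPathLaw μ g (G.codeShift^[n] ⁻¹' {x | G.StartsWell x}ᶜ) = 0 by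
    have h' : ∀ᵐ x ∂(G.randomPathLaw μ g), ∀ n, G.StartsWell (G.codeShift^[n] x) := by
      rw [ae_all_iff]
      intro n
      exact h n
    filter_upwards [h'] with x hx using isPathCode_of_startsWell hx
  have hvertex : ∀ n (v : V), G.codeShift^[n] (v, fun _ => Sum.inr ()) =
      (v, fun _ => (Sum.inr () : E ⊕ Unit)) := fun n v => Function.iterate_fixed rfl n
  have hsecond : ∀ n, ∫⁻ v, (G.codeShift^[n] ⁻¹' {x | G.StartsWell x}ᶜ).indicator 1
      (v, fun _ => (Sum.inr () : E ⊕ Unit)) ∂m = 0 := by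
    intro n
    refine lintegral_eq_zero_of_ae_eq_zero ?_
    filter_upwards [measure_eq_zero_iff_ae_notMem.1 hm] with v hv
    refine indicator_of_notMem (fun h => ?_) _
    rw [mem_preimage, hvertex] at h
    exact h (Or.inr ⟨rfl, rfl, hv⟩)
  intro n
  induction n with
  | zero =>
    rw [← lintegral_indicator_one (hmeas 0), lintegral_randomPathLaw_eq_add hg hstep
      (measurable_one.indicator (hmeas 0)), hsecond 0, add_zero]
    have h0 : ∀ (e : E) (x : ℕ → E ⊕ Unit), (G.codeShift^[0] ⁻¹' {x | G.StartsWell x}ᶜ).indicator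
        (1 : V × (ℕ → E ⊕ Unit) → ℝ≥0∞) (G.consCode e x) = 0 := fun e x =>
      indicator_of_notMem
        (not_not.2 (Or.inl ⟨e, rfl, rfl⟩ : G.StartsWell (G.consCode e x))) _
    simp only [h0, tsum_zero, lintegral_zero]
  | succ n ih =>
    rw [← lintegral_indicator_one (hmeas (n + 1)), lintegral_randomPathLaw_eq_add hg hstep
      (measurable_one.indicator (hmeas (n + 1))), hsecond (n + 1), add_zero]
    rw [← lintegral_indicator_one (hmeas n), lintegral_randomPathLaw hg
      (measurable_one.indicator (hmeas n))] at ih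
    have hF : Measurable fun z : V × (ℕ → I) =>
        (G.codeShift^[n] ⁻¹' {x | G.StartsWell x}ᶜ).indicator (1 : V × (ℕ → E ⊕ Unit) → ℝ≥0∞)
          (z.1, G.randomEdges g z.1 z.2) :=
      (measurable_one.indicator (hmeas n)).comp
        (measurable_fst.prodMk (measurable_randomEdges hg))
    have hF' : Measurable fun v => ∫⁻ u, (G.codeShift^[n] ⁻¹' {x | G.StartsWell x}ᶜ).indicator
        (1 : V × (ℕ → E ⊕ Unit) → ℝ≥0∞) (v, G.randomEdges g v u) ∂uniformLaw := hF.lintegral_prod_right'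
    refine lintegral_eq_zero_of_ae_eq_zero ?_
    filter_upwards [(lintegral_eq_zero_iff hF').1 ih] with v hv
    refine lintegral_eq_zero_of_ae_eq_zero ?_
    filter_upwards [(lintegral_eq_zero_iff (hF.comp measurable_prodMk_left)).1 hv] with u hu
    refine ENNReal.tsum_eq_zero.2 fun e => indicator_of_notMem (fun h => ?_) _
    have he : G.s e = v := e.2
    rw [mem_preimage, Function.iterate_succ_apply, codeShift_consCode, he] at h
    exact one_ne_zero ((indicator_of_mem (show (v, G.randomEdges g v u) ∈
      G.codeShift^[n] ⁻¹' {x | G.StartsWell x}ᶜ from h) (1 : V × (ℕ → E ⊕ Unit) → ℝ≥0∞)).symm.trans hu)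

end TopologicalGraph

/-! ### Existence of invariant measures and convexity -/

theorem MeasureTheory.Measure.regular_add_smul {X : Type*} [TopologicalSpace X]
    [PseudoMetrizableSpace X] [LocallyCompactSpace X] [SigmaCompactSpace X] [MeasurableSpace X]
    [BorelSpace X] (μ₁ μ₂ : Measure X) [IsFiniteMeasureOnCompacts μ₁]
    [IsFiniteMeasureOnCompacts μ₂] (a b : ℝ≥0) : (a • μ₁ + b • μ₂).Regular := by
  have : IsFiniteMeasureOnCompacts (a • μ₁ + b • μ₂) := ⟨fun K hK => by
    simp only [Measure.add_apply, Measure.smul_apply, ENNReal.smul_def, smul_eq_mul]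
    exact ENNReal.add_lt_top.2 ⟨ENNReal.mul_lt_top ENNReal.coe_lt_top hK.measure_lt_top,
      ENNReal.mul_lt_top ENNReal.coe_lt_top hK.measure_lt_top⟩⟩
  infer_instance

namespace TopologicalGraph

open ProbabilityTheory unitInterval

variable {V E : Type*}
  [TopologicalSpace V] [T2Space V] [LocallyCompactSpace V] [SecondCountableTopology V]
  [MeasurableSpace V] [BorelSpace V]
  [TopologicalSpace E] [T2Space E] [LocallyCompactSpace E] [SecondCountableTopology E]
  [MeasurableSpace E] [BorelSpace E]
  {G : TopologicalGraph V E}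

namespace BoundaryPath

theorem regular_of_map_range {ν : Measure G.BoundaryPath}
    (h : IsFiniteMeasureOnCompacts (ν.map range)) : ν.Regular := by
  have : IsFiniteMeasureOnCompacts ν := ⟨fun K hK => by
    have hK' := hK.image continuous_range
    refine (measure_mono (subset_preimage_image range K)).trans_lt ?_
    rw [← Measure.map_apply continuous_range.measurable hK'.measurableSet]
    exact hK'.measure_lt_top⟩
  infer_instance

/-- Counts the edges over `v` whose prepending to `x` lands in `A`: injectivity of the shift on `A`
allows at most one, and there is one exactly when `(v, x)` encodes a shifted path of `A`. -/
theorem tsum_indicator_consCode {A : Set G.BoundaryPath} (hA : ∀ α ∈ A, ¬ α.IsVertex)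
    (hinj : InjOn shift A) (v : V) (x : ℕ → E ⊕ Unit) :
    ∑' e : G.s ⁻¹' {v}, (code '' A).indicator (1 : V × (ℕ → E ⊕ Unit) → ℝ≥0∞) (G.consCode e x) =
      (code '' (shift '' A)).indicator 1 (v, x) := by
  by_cases hx : (v, x) ∈ code '' (shift '' A)
  · obtain ⟨_, ⟨α, hα, rfl⟩, hαx⟩ := hx
    have hedge : ∃ e, α.edge 0 = Sum.inl e := by
      rcases h : α.edge 0 with e | u
      · exact ⟨e, rfl⟩
      · exact absurd (isVertex_iff.2 h) (hA α hα)
    obtain ⟨e, he⟩ := hedge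
    have hv : G.s e = v := (range_shift he).symm.trans (congrArg Prod.fst hαx)
    have hx' : α.shift.edge = x := congrArg Prod.snd hαx
    have hcode : α.code = G.consCode e x := hx' ▸ eq_consCode he
    have hmem : (v, x) ∈ code '' (shift '' A) := ⟨_, ⟨α, hα, rfl⟩, hαx⟩
    have hmem' : G.consCode e x ∈ code '' A := ⟨α, hα, hcode⟩
    rw [indicator_of_mem hmem, tsum_eq_single (⟨e, hv⟩ : G.s ⁻¹' {v}),
      indicator_of_mem hmem']
    · rfl
    · rintro ⟨e', he'⟩ hne
      refine indicator_of_notMem ?_ _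
      rintro ⟨β, hβ, hβx⟩
      refine hne (Subtype.ext ?_)
      have hβs : β.shift = α.shift := code_injective (by
        rw [hαx, code_shift, hβx, codeShift_consCode, he'])
      obtain rfl := hinj hβ hα hβs
      exact Sum.inl.inj ((congrFun (congrArg Prod.snd hβx) 0).symm.trans he)
  · rw [indicator_of_notMem hx, ENNReal.tsum_eq_zero]
    rintro ⟨e, he⟩
    refine indicator_of_notMem ?_ _
    rintro ⟨α, hα, hαx⟩
    refine hx ⟨_, ⟨α, hα, rfl⟩, ?_⟩
    rw [code_shift, hαx, codeShift_consCode, he]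

theorem exists_isInvariant_map_range_eq {μ : Measure V} (hμ : G.IsVertexInvariant μ) :
    ∃ ν : Measure G.BoundaryPath, IsInvariant ν ∧ ν.map range = μ := by
  have := PolishSpace.of_locallyCompact (X := E)
  have hreg := hμ.regular
  obtain ⟨m, hm, hm0⟩ := hμ.exists_map_pullback_add_eq
  have hr : Measurable fun e : E => (G.r e, (Sum.inl e : E ⊕ Unit)) :=
    G.continuous_r.measurable.prodMk measurable_inl
  have hi : Measurable fun v : V => (v, (Sum.inr () : E ⊕ Unit)) :=
    measurable_id.prodMk measurable_const
  -- The intended joint law of the initial vertex and the first step: `s^*μ` governs moving, `m`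
  -- stopping. Its first marginal is `r_* s^*μ + m = μ`.
  let ρ : Measure (V × (E ⊕ Unit)) :=
    (G.pullback μ).map (fun e => (G.r e, Sum.inl e)) + m.map fun v => (v, Sum.inr ())
  have hρ : ρ.fst = μ := by
    rw [Measure.fst, Measure.map_add _ _ measurable_fst, Measure.map_map measurable_fst hr,
      Measure.map_map measurable_fst hi]
    conv_rhs => rw [← hm, ← Measure.map_id (μ := m)]
    rfl
  have : SigmaFinite ρ.fst := by
    rw [hρ]
    infer_instance
  obtain ⟨g, hg, hstep⟩ := exists_measurable_map_prod_unitInterval ρ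
  rw [hρ] at hstep
  have hvalid : ∀ᵐ x ∂(G.randomPathLaw μ g), x ∈ Set.range (code : G.BoundaryPath → _) := by
    rw [range_code]
    exact ae_isPathCode_randomPathLaw hg hstep hm0
  let ν : Measure G.BoundaryPath := (G.randomPathLaw μ g).comap code
  have hνcode : ν.map code = G.randomPathLaw μ g := by
    rw [measurableEmbedding_code.map_comap, Measure.restrict_eq_self_of_ae_mem hvalid]
  have hνrange : ν.map range = μ := by
    have h1 : (range : G.BoundaryPath → V) = Prod.fst ∘ code := rfl
    rw [h1, ← Measure.map_map measurable_fst measurable_code, hνcode, randomPathLaw,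
      Measure.map_map measurable_fst (measurable_fst.prodMk (measurable_randomEdges hg))]
    exact Measure.fst_prod
  refine ⟨ν, ⟨regular_of_map_range (by rw [hνrange]; infer_instance), fun A hA hpos hinj => ?_⟩,
    hνrange⟩
  have hsA : MeasurableSet (shift '' A) := hA.image_of_measurable_injOn measurable_shift hinj
  have hcA := measurableEmbedding_code.measurableSet_image.2 hA
  have hcsA := measurableEmbedding_code.measurableSet_image.2 hsA
  -- The measure of `A` is expanded by its first edge and that of `shift '' A` is not. The stopping
  -- term vanishes because `A` contains no vertices, and the sums over fibres of `s` agree with the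
  -- indicator of the shifted set pointwise.
  rw [measurableEmbedding_code.comap_apply, measurableEmbedding_code.comap_apply,
    ← lintegral_indicator_one hcA, ← lintegral_indicator_one hcsA,
    lintegral_randomPathLaw hg (measurable_one.indicator hcsA),
    lintegral_randomPathLaw_eq_add hg hstep (measurable_one.indicator hcA)]
  have h0 : ∀ v : V, (code '' A).indicator (1 : V × (ℕ → E ⊕ Unit) → ℝ≥0∞)
      (v, fun _ => Sum.inr ()) = 0 := by
    intro v
    refine indicator_of_notMem ?_ _
    rintro ⟨α, hα, hαv⟩
    exact hpos α hα (isVertex_iff.2 (congrFun (congrArg Prod.snd hαv) 0))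
  simp only [h0, lintegral_zero, add_zero, tsum_indicator_consCode hpos hinj]

theorem IsInvariant.add_smul {ν₁ ν₂ : Measure G.BoundaryPath} (h₁ : IsInvariant ν₁)
    (h₂ : IsInvariant ν₂) (a b : ℝ≥0) : IsInvariant (a • ν₁ + b • ν₂) := by
  have := h₁.regular
  have := h₂.regular
  refine ⟨Measure.regular_add_smul _ _ a b, fun A hA hpos hinj => ?_⟩
  simp only [Measure.add_apply, Measure.smul_apply, h₁.shift_image A hA hpos hinj,
    h₂.shift_image A hA hpos hinj]

end BoundaryPath

theorem lintegral_pullback_add_smul (μ₁ μ₂ : Measure V) (a b : ℝ≥0) {f : E → ℝ≥0∞}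
    (hf : Measurable f) : ∫⁻ e, f e ∂(G.pullback (a • μ₁ + b • μ₂)) =
      a • ∫⁻ e, f e ∂(G.pullback μ₁) + b • ∫⁻ e, f e ∂(G.pullback μ₂) := by
  simp only [lintegral_pullback G _ hf, lintegral_add_measure, lintegral_smul_measure]

theorem IsVertexInvariant.add_smul {μ₁ μ₂ : Measure V} (h₁ : G.IsVertexInvariant μ₁)
    (h₂ : G.IsVertexInvariant μ₂) (a b : ℝ≥0) : G.IsVertexInvariant (a • μ₁ + b • μ₂) := by
  have := h₁.regular
  have := h₂.regular
  have hreg := Measure.regular_add_smul μ₁ μ₂ a b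
  have hmeas : ∀ f : V → ℝ, Continuous f → Measurable fun e => ENNReal.ofReal (f (G.r e)) :=
    fun f hf => ENNReal.measurable_ofReal.comp (hf.comp G.continuous_r).measurable
  refine ⟨hreg, fun f hf hc h0 => ?_, fun f hf hc h0 hs => ?_⟩
  · rw [lintegral_pullback_add_smul _ _ _ _ (hmeas f hf), lintegral_add_measure,
      lintegral_smul_measure, lintegral_smul_measure]
    gcongr
    exacts [h₁.le f hf hc h0, h₂.le f hf hc h0]
  · rw [lintegral_pullback_add_smul _ _ _ _ (hmeas f hf), lintegral_add_measure,
      lintegral_smul_measure, lintegral_smul_measure, h₁.eq f hf hc h0 hs, h₂.eq f hf hc h0 hs]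

end TopologicalGraph

end

theorem proposition2p4 {V E : Type*}
    [TopologicalSpace V] [T2Space V] [LocallyCompactSpace V] [SecondCountableTopology V]
    [MeasurableSpace V] [BorelSpace V]
    [TopologicalSpace E] [T2Space E] [LocallyCompactSpace E] [SecondCountableTopology E]
    [MeasurableSpace E] [BorelSpace E]
    (G : TopologicalGraph V E) :
    Convex ℝ≥0 {ν : Measure G.BoundaryPath | TopologicalGraph.BoundaryPath.IsInvariant ν} ∧
    Convex ℝ≥0 {μ : Measure V | G.IsVertexInvariant μ} ∧
    Set.BijOn (fun ν : Measure G.BoundaryPath => ν.map TopologicalGraph.BoundaryPath.range)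
      {ν : Measure G.BoundaryPath | TopologicalGraph.BoundaryPath.IsInvariant ν}
      {μ : Measure V | G.IsVertexInvariant μ} ∧
    ∀ ν₁ ν₂ : Measure G.BoundaryPath,
      TopologicalGraph.BoundaryPath.IsInvariant ν₁ →
      TopologicalGraph.BoundaryPath.IsInvariant ν₂ →
      ∀ a b : ℝ≥0, a + b = 1 →
        (a • ν₁ + b • ν₂).map TopologicalGraph.BoundaryPath.range =
          a • ν₁.map TopologicalGraph.BoundaryPath.range +
            b • ν₂.map TopologicalGraph.BoundaryPath.range := by
  refine ⟨fun ν₁ h₁ ν₂ h₂ a b _ _ _ => h₁.add_smul h₂ a b,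
    fun μ₁ h₁ μ₂ h₂ a b _ _ _ => h₁.add_smul h₂ a b,
    ⟨fun ν hν => hν.isVertexInvariant_map, fun ν₁ h₁ ν₂ h₂ h => h₁.eq_of_map_range_eq h₂ h,
      fun μ hμ => TopologicalGraph.BoundaryPath.exists_isInvariant_map_range_eq hμ⟩,
    fun ν₁ ν₂ _ _ a b _ => ?_⟩
  rw [Measure.map_add _ _ TopologicalGraph.BoundaryPath.continuous_range.measurable,
    Measure.map_smul, Measure.map_smul]
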